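/- Let $K$ be a field and let $q\in K$ be nonzero and not a root of unity (for example $K=\mathbb{C}(q)$). **The algebra.** Let $A_q(B_3)$ be the $K$-algebra with generators $t_{ij}$ $(1\le i,j\le 7)$ and relations (repeated indices summed) $$R_{ij,mp}\,t_{mk}t_{pl}=t_{jp}t_{im}\,R_{mp,kl},\qquad C_{jk}C_{lm}\,t_{ij}t_{lk}=C_{ij}C_{kl}\,t_{kj}t_{lm}=\delta_{im},$$ where $C_{ij}=\delta_{i,8-j}\,q^{\varrho_j}$, $(\varrho_1,\dots,\varrho_7)=(5,3,1,0,-1,-3,-5)$ and, with $i'=8-i$, $$\sum R_{ij,mp}E_{im}\otimes E_{jp}=q^2\sum_{i\ne i'}E_{ii}\otimes E_{ii}+E_{44}\otimes E_{44}+\sum_{i\ne j,j'}E_{ii}\otimes E_{jj}+q^{-2}\sum_{i\neq i'}E_{ii}\otimes E_{i'i'}+(q^2-q^{-2})\sum_{i>j}\bigl(E_{ij}\otimes E_{ji}-q^{\varrho_i-\varrho_j}E_{ij}\otimes E_{i'j'}\bigr).$$ Its coproduct is $\Delta(t_{ij})=\sum_k t_{ik}\otimes t_{kj}$. **The oscillator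 algebra.** Let $\mathrm{Osc}_{q^2}$ be the algebra generated by $A^\pm,\mathsf K$ with relations $\mathsf KA^{\pm}=q^{\pm2}A^{\pm}\mathsf K$, $A^-A^+=1-q^4\mathsf K^2$, $A^+A^-=1-\mathsf K^2$. It acts on $\mathcal F=\bigoplus_{m\ge0}K|m\rangle$ by $\mathsf K|m\rangle=q^{2m}|m\rangle$, $A^+|m\rangle=|m+1\rangle$, $A^-|m\rangle=(1-q^{4m})|m-1\rangle$. **The representations.** Let $\alpha_i,\beta_i,\mu_i,\nu_i,\kappa_i\in K^\times$ and $\sigma_i\in\{1,-1\}$ $(i=1,2)$ satisfy $$\alpha_i\beta_i=-q^2\mu_i\nu_i,\qquad \kappa_1=\sigma_1,\qquad \kappa_1=\kappa_2=\sigma_2,\qquad \alpha_1\beta_1=\alpha_2\beta_2 .$$ Put $$M_i=\begin{pmatrix}\mu_iA^-&\alpha_i\mathsf K\\ \beta_i\mathsf K&\nu_iA^+\end{pmatrix},\qquad M_i'=\begin{pmatrix}\nu_i^{-1}A^-&q^2\beta_i^{-1}\mathsf K\\ q^2\alpha_i^{-1}\mathsf K&\mu_i^{-1}A^+\end{pmatrix}.$$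 Then there are (unique) algebra homomorphisms $\pi_1,\pi_2:A_q(B_3)\to\mathrm{Osc}_{q^2}$ that send the matrix $(t_{ij})$ to the block diagonal matrices $\mathrm{diag}(M_1,\kappa_1,\sigma_1,\kappa_1^{-1},M_1')$ and $\mathrm{diag}(\kappa_2,M_2,\sigma_2,M_2',\kappa_2^{-1})$ respectively. Let $\pi_{121}=\pi_1\otimes\pi_2\otimes\pi_1$ and $\pi_{212}=\pi_2\otimes\pi_1\otimes\pi_2$ be the representations of $A_q(B_3)$ on $\mathcal F^{\otimes3}$ obtained through the iterated coproduct. **Theorem 2.** There is exactly one linear map $\Phi:\mathcal F^{\otimes3}\to\mathcal F^{\otimes3}$ such that $\pi_{212}(f)\,\Phi=\Phi\,\pi_{121}(f)$ for all $f\in A_q(B_3)$ and $\Phi(|0\rangle\otimes|0\rangle\otimes|0\rangle)=|0\rangle\otimes|0\rangle\otimes|0\rangle$. It is bijective. With $P_{13}(x\otimes y\otimes z)=z\otimes y\otimes x$, the matrix elements of $S=\Phi P_{13}$, given by $S(|i\rangle\otimes|j\rangle\otimes|k\rangle)=\sum_{a,b,c\ge0}S^{abc}_{ijk}\,|a\rangle\otimes|b\rangle\otimes|c\rangle$,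 are $$S^{abc}_{ijk}=(-\alpha_1\beta_1q^{-2})^j\,\mu_1^{a-j+k}\,\mu_2^{b-a-k}\,\sigma_1^{b+j}\,\mathscr S^{abc}_{ijk},$$ $$\mathscr S^{abc}_{ijk}=\delta_{i+j}^{a+b}\,\delta_{j+k}^{b+c}\sum_{\lambda+\mu=b}(-1)^\lambda q^{2i(c-j)+2(k+1)\lambda+2\mu(\mu-k)}\left[{i,\;j,\;c+\mu\atop \mu,\;\lambda,\;i-\mu,\;j-\lambda,\;c}\right]_{q^4}.$$ Here $\lambda,\mu\ge 0$, $(p)_i=\prod_{j=1}^i(1-p^j)$, and $\left[{i_1,\dots,i_r\atop j_1,\dots,j_s}\right]_p=\prod_k(p)_{i_k}/\prod_k(p)_{j_k}$ if all entries are nonnegative and $0$ otherwise. Thus $\mathscr S=\mathscr R|_{q\to q^2}$, where $\mathscr R$ is the 3D $R$ matrix $$\mathscr R^{abc}_{ijk}=\delta_{i+j}^{a+b}\,\delta_{j+k}^{b+c}\sum_{\lambda+\mu=b}(-1)^\lambda q^{i(c-j)+(k+1)\lambda+\mu(\mu-k)}\left[{i,\;j,\;c+\mu\atop \mu,\;\lambda,\;i-\mu,\;j-\lambda,\;c}\right]_{q^2}.$$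 -/

import Mathlib

open scoped TensorProduct

noncomputable section

namespace QFunB

variable {K : Type*} [Field K]

/-! ## The quantized algebra of functions of type B -/

/-- The exponents `(2n-1, …, 3, 1, 0, -1, -3, …, -2n+1)`. Indices are `0, …, 2n`. -/
def rho (n : ℕ) (i : Fin (2 * n + 1)) : ℤ :=
  if (i : ℕ) < n then 2 * (n : ℤ) - 1 - 2 * (i : ℕ)
  else if (i : ℕ) = n then 0
  else 2 * (n : ℤ) + 1 - 2 * (i : ℕ)

/-- `C i j = δ_{i, N+1-j} q^{ρ_j}`; `Fin.rev j` is the index `N+1-j`. -/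
def C (n : ℕ) (q : K) (i j : Fin (2 * n + 1)) : K :=
  if i = Fin.rev j then q ^ rho n j else 0

/-- The coefficient `R_{ij,mp}` of `E_{im} ⊗ E_{jp}` in the constant quantum R matrix of the
vector representation of type B, i.e. in (with `i' = N+1-i`)
`q² ∑_{i ≠ i'} E_ii ⊗ E_ii + E_cc ⊗ E_cc + ∑_{i ≠ j, j'} E_ii ⊗ E_jj + q⁻² ∑_{i ≠ i'} E_ii ⊗ E_i'i'
 + (q² - q⁻²) ∑_{i > j} E_ij ⊗ E_ji - (q² - q⁻²) ∑_{i > j} q^{ρ_i - ρ_j} E_ij ⊗ E_i'j'`,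
where `c` is the middle index. This is the limit `q² lim_{x → ∞} x⁻² R(x)` at `k = q⁻²` of
Jimbo's R matrix `R(x)`, with parameter `k`, of the affine type B vector representation. -/
def R (n : ℕ) (q : K) (i j m p : Fin (2 * n + 1)) : K :=
  (if i = m ∧ j = p then
    (if i = j then (if i = Fin.rev i then 1 else q ^ (2 : ℤ))
     else if j = Fin.rev i then q ^ (-2 : ℤ) else 1)
   else 0)
  + (if i = p ∧ j = m ∧ m < i then q ^ (2 : ℤ) - q ^ (-2 : ℤ) else 0)
  - (if j = Fin.rev i ∧ p = Fin.rev m ∧ m < i then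
      (q ^ (2 : ℤ) - q ^ (-2 : ℤ)) * q ^ (rho n i - rho n m) else 0)

/-- The free generators. -/
def x (K : Type*) [Field K] (n : ℕ) (i j : Fin (2 * n + 1)) :
    FreeAlgebra K (Fin (2 * n + 1) × Fin (2 * n + 1)) :=
  FreeAlgebra.ι K (i, j)

/-- The defining relations of `A_q(B_n)`. -/
inductive Rel (n : ℕ) (q : K) :
    FreeAlgebra K (Fin (2 * n + 1) × Fin (2 * n + 1)) →
    FreeAlgebra K (Fin (2 * n + 1) × Fin (2 * n + 1)) → Prop
  | rtt (i j k l : Fin (2 * n + 1)) :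
      Rel n q (∑ m, ∑ p, R n q i j m p • (x K n m k * x K n p l))
        (∑ m, ∑ p, R n q m p k l • (x K n j p * x K n i m))
  | orth_left (i m : Fin (2 * n + 1)) :
      Rel n q (∑ j, ∑ k, ∑ l, (C n q j k * C n q l m) • (x K n i j * x K n l k))
        (if i = m then 1 else 0)
  | orth_right (i m : Fin (2 * n + 1)) :
      Rel n q (∑ j, ∑ k, ∑ l, (C n q i j * C n q k l) • (x K n k j * x K n l m))
        (if i = m then 1 else 0)

/-- The algebra `A_q(B_n)`. -/
abbrev A (n : ℕ) (q : K) : Type _ := RingQuot (Rel n q)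

/-- The generators `t_{ij}` of `A_q(B_n)`. -/
def t (n : ℕ) (q : K) (i j : Fin (2 * n + 1)) : A n q :=
  RingQuot.mkAlgHom K (Rel n q) (x K n i j)

theorem rtt (n : ℕ) (q : K) (i j k l : Fin (2 * n + 1)) :
    ∑ m, ∑ p, R n q i j m p • (t n q m k * t n q p l) =
      ∑ m, ∑ p, R n q m p k l • (t n q j p * t n q i m) := by
  have h := RingQuot.mkAlgHom_rel K (Rel.rtt (q := q) i j k l)
  simp only [map_sum, map_smul, map_mul] at h
  exact h

theorem orth_left (n : ℕ) (q : K) (i m : Fin (2 * n + 1)) :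
    ∑ j, ∑ k, ∑ l, (C n q j k * C n q l m) • (t n q i j * t n q l k) =
      if i = m then 1 else 0 := by
  have h := RingQuot.mkAlgHom_rel K (Rel.orth_left (q := q) i m)
  rw [apply_ite (RingQuot.mkAlgHom K (Rel n q)), map_one, map_zero] at h
  simp only [map_sum, map_smul, map_mul] at h
  exact h

theorem orth_right (n : ℕ) (q : K) (i m : Fin (2 * n + 1)) :
    ∑ j, ∑ k, ∑ l, (C n q i j * C n q k l) • (t n q k j * t n q l m) =
      if i = m then 1 else 0 := by
  have h := RingQuot.mkAlgHom_rel K (Rel.orth_right (q := q) i m)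
  rw [apply_ite (RingQuot.mkAlgHom K (Rel n q)), map_one, map_zero] at h
  simp only [map_sum, map_smul, map_mul] at h
  exact h

theorem rho_rev (n : ℕ) (i : Fin (2 * n + 1)) : rho n (Fin.rev i) = - rho n i := by
  have hi := i.isLt
  simp only [rho, Fin.val_rev]
  split_ifs <;> omega

theorem C_mul_C (n : ℕ) {q : K} (hq : q ≠ 0) (i m : Fin (2 * n + 1)) :
    ∑ j, C n q i j * C n q j m = if i = m then 1 else 0 := by
  rw [Finset.sum_eq_single (Fin.rev m)]
  · by_cases h : i = m
    · subst h
      simp [C, rho_rev, inv_mul_cancel₀ (zpow_ne_zero _ hq)]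
    · simp [C, h]
  · intro j _ hj
    simp [C, hj]
  · simp

section Coproduct

variable {I : Type*} [Fintype I] {B : Type*} [Ring B] [Algebra K B]

theorem sum_left [DecidableEq I] {c : I → I → K} {u : I → I → B}
    (hc : ∀ i m, ∑ j, c i j * c j m = if i = m then 1 else 0)
    (h : ∀ i m, ∑ j, ∑ k, ∑ l, (c j k * c l m) • (u i j * u l k) = if i = m then 1 else 0)
    (a b : I) : ∑ j, ∑ k, c j k • (u a j * u b k) = c a b • (1 : B) := by
  have h1 : ∑ m, c m b • (∑ j, ∑ k, ∑ l, (c j k * c l m) • (u a j * u l k)) = c a b • (1 : B) := by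
    simp [h]
  have e : ∀ l, ∑ m, c m b * c l m = if l = b then 1 else 0 := by
    intro l
    rw [← hc l b]
    exact Finset.sum_congr rfl fun m _ => mul_comm _ _
  have h2 : ∀ j k, ∑ m, ∑ l, (c m b * (c j k * c l m)) • (u a j * u l k)
      = c j k • (u a j * u b k) := by
    intro j k
    rw [Finset.sum_comm]
    have : ∀ l, ∑ m, (c m b * (c j k * c l m)) • (u a j * u l k)
        = (if l = b then 1 else 0 : K) • c j k • (u a j * u l k) := by
      intro l
      rw [← e l, smul_smul, Finset.sum_mul, Finset.sum_smul]
      exact Finset.sum_congr rfl fun m _ => by congr 1; ring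
    simp [this]
  rw [← h1]
  symm
  simp only [Finset.smul_sum, smul_smul]
  rw [Finset.sum_comm]
  refine Finset.sum_congr rfl fun j _ => ?_
  rw [Finset.sum_comm]
  refine Finset.sum_congr rfl fun k _ => ?_
  rw [← h2 j k]

theorem sum_right [DecidableEq I] {c : I → I → K} {u : I → I → B}
    (hc : ∀ i m, ∑ j, c i j * c j m = if i = m then 1 else 0)
    (h : ∀ i m, ∑ j, ∑ k, ∑ l, (c i j * c k l) • (u k j * u l m) = if i = m then 1 else 0)
    (a b : I) : ∑ k, ∑ l, c k l • (u k a * u l b) = c a b • (1 : B) := by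
  have h1 : ∑ i, c a i • (∑ j, ∑ k, ∑ l, (c i j * c k l) • (u k j * u l b)) = c a b • (1 : B) := by
    simp [h]
  have h2 : ∀ j, ∑ i, c a i • (∑ k, ∑ l, (c i j * c k l) • (u k j * u l b))
      = (if a = j then 1 else 0 : K) • ∑ k, ∑ l, c k l • (u k j * u l b) := by
    intro j
    rw [← hc a j, Finset.sum_smul]
    refine Finset.sum_congr rfl fun i _ => ?_
    simp only [Finset.smul_sum, smul_smul, mul_assoc]
  rw [← h1]
  symm
  rw [Finset.sum_congr rfl fun i _ => Finset.smul_sum, Finset.sum_comm]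
  simp [h2]

theorem dt_mul (u : I → I → B) (i j k l : I) :
    (∑ a, u i a ⊗ₜ[K] u a j) * (∑ b, u k b ⊗ₜ[K] u b l) =
      ∑ a, ∑ b, (u i a * u k b) ⊗ₜ[K] (u a j * u b l) := by
  simp only [Finset.sum_mul_sum, Algebra.TensorProduct.tmul_mul_tmul]

theorem sum_swap {M : Type*} [AddCommMonoid M] (f : I → I → I → I → M) :
    ∑ m, ∑ p, ∑ a, ∑ b, f m p a b = ∑ a, ∑ b, ∑ m, ∑ p, f m p a b := by
  simp only [← Fintype.sum_prod_type' (f := fun a b => ∑ m, ∑ p, f m p a b),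
    ← Fintype.sum_prod_type' (f := fun m p => ∑ a, ∑ b, f m p a b)]
  simp only [← Fintype.sum_prod_type']
  rw [← Fintype.sum_equiv (Equiv.prodComm (I × I) (I × I)) (fun z => f z.1.1 z.1.2 z.2.1 z.2.2)
    (fun z => f z.2.1 z.2.2 z.1.1 z.1.2) (fun _ => rfl)]

theorem dt_rtt {r : I → I → I → I → K} {u : I → I → B}
    (h : ∀ i j k l, ∑ m, ∑ p, r i j m p • (u m k * u p l) =
      ∑ m, ∑ p, r m p k l • (u j p * u i m)) (i j k l : I) :
    ∑ m, ∑ p, r i j m p • ((∑ a, u m a ⊗ₜ[K] u a k) * (∑ b, u p b ⊗ₜ[K] u b l)) =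
      ∑ m, ∑ p, r m p k l • ((∑ b, u j b ⊗ₜ[K] u b p) * (∑ a, u i a ⊗ₜ[K] u a m)) := by
  have e1 : ∑ m, ∑ p, r i j m p • ((∑ a, u m a ⊗ₜ[K] u a k) * (∑ b, u p b ⊗ₜ[K] u b l)) =
      ∑ a, ∑ b, (∑ m, ∑ p, r i j m p • (u m a * u p b)) ⊗ₜ[K] (u a k * u b l) := by
    simp only [dt_mul, Finset.smul_sum, TensorProduct.sum_tmul, TensorProduct.smul_tmul']
    exact sum_swap _
  have e2 : ∑ m, ∑ p, r m p k l • ((∑ b, u j b ⊗ₜ[K] u b p) * (∑ a, u i a ⊗ₜ[K] u a m)) =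
      ∑ p, ∑ m, (u j p * u i m) ⊗ₜ[K] (∑ a, ∑ b, r a b k l • (u p b * u m a)) := by
    simp only [dt_mul, Finset.smul_sum, TensorProduct.tmul_sum, TensorProduct.tmul_smul]
    exact sum_swap _
  rw [e1, e2, Finset.sum_comm (f := fun p m => (u j p * u i m) ⊗ₜ[K] _)]
  simp only [h i j, ← h _ _ k l]
  simp only [TensorProduct.sum_tmul, TensorProduct.tmul_sum, ← TensorProduct.smul_tmul',
    TensorProduct.tmul_smul]
  exact sum_swap _

theorem dt_left [DecidableEq I] {c : I → I → K} {u : I → I → B}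
    (hc : ∀ i m, ∑ j, c i j * c j m = if i = m then 1 else 0)
    (h : ∀ i m, ∑ j, ∑ k, ∑ l, (c j k * c l m) • (u i j * u l k) = if i = m then 1 else 0)
    (i m : I) :
    ∑ j, ∑ k, ∑ l, (c j k * c l m) •
      ((∑ a, u i a ⊗ₜ[K] u a j) * (∑ b, u l b ⊗ₜ[K] u b k)) = if i = m then 1 else 0 := by
  have e1 : ∀ l, ∑ j, ∑ k, (c j k * c l m) •
      ((∑ a, u i a ⊗ₜ[K] u a j) * (∑ b, u l b ⊗ₜ[K] u b k)) =
      ∑ a, ∑ b, ((c a b * c l m) • (u i a * u l b)) ⊗ₜ[K] (1 : B) := by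
    intro l
    have e2 : ∀ a b, ((c a b * c l m) • (u i a * u l b)) ⊗ₜ[K] (1 : B) =
        (c l m • (u i a * u l b)) ⊗ₜ[K] (∑ j, ∑ k, c j k • (u a j * u b k)) := by
      intro a b
      rw [sum_left hc h, TensorProduct.tmul_smul, TensorProduct.smul_tmul', smul_smul]
    simp only [e2, dt_mul, Finset.smul_sum, TensorProduct.tmul_sum, TensorProduct.tmul_smul,
      TensorProduct.smul_tmul', smul_smul]
    exact sum_swap _
  have e3 : ∀ (M : Type _) [AddCommMonoid M] (f : I → I → I → M),
      ∑ j, ∑ k, ∑ l, f j k l = ∑ l, ∑ j, ∑ k, f j k l := by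
    intro M _ f
    rw [Finset.sum_comm (s := Finset.univ (α := I)) (f := fun l j => ∑ k, f j k l)]
    exact Finset.sum_congr rfl fun j _ => Finset.sum_comm
  rw [e3, Finset.sum_congr rfl fun l _ => e1 l, ← e3]
  simp only [← TensorProduct.sum_tmul]
  rw [h]
  split_ifs
  · rfl
  · simp

theorem dt_right [DecidableEq I] {c : I → I → K} {u : I → I → B}
    (hc : ∀ i m, ∑ j, c i j * c j m = if i = m then 1 else 0)
    (h : ∀ i m, ∑ j, ∑ k, ∑ l, (c i j * c k l) • (u k j * u l m) = if i = m then 1 else 0)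
    (i m : I) :
    ∑ j, ∑ k, ∑ l, (c i j * c k l) •
      ((∑ a, u k a ⊗ₜ[K] u a j) * (∑ b, u l b ⊗ₜ[K] u b m)) = if i = m then 1 else 0 := by
  have e1 : ∀ j, ∑ k, ∑ l, (c i j * c k l) •
      ((∑ a, u k a ⊗ₜ[K] u a j) * (∑ b, u l b ⊗ₜ[K] u b m)) =
      ∑ a, ∑ b, (1 : B) ⊗ₜ[K] ((c i j * c a b) • (u a j * u b m)) := by
    intro j
    have e2 : ∀ a b, (1 : B) ⊗ₜ[K] ((c i j * c a b) • (u a j * u b m)) =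
        (∑ k, ∑ l, c k l • (u k a * u l b)) ⊗ₜ[K] (c i j • (u a j * u b m)) := by
      intro a b
      rw [sum_right hc h, ← TensorProduct.smul_tmul', TensorProduct.tmul_smul,
        TensorProduct.tmul_smul, smul_smul, mul_comm]
    simp only [e2, dt_mul, Finset.smul_sum, TensorProduct.sum_tmul, ← TensorProduct.smul_tmul',
      TensorProduct.tmul_smul, smul_smul]
    rw [sum_swap]
  rw [Finset.sum_congr rfl fun j _ => e1 j]
  simp only [← TensorProduct.tmul_sum]
  rw [h]
  split_ifs
  · rfl
  · simp

end Coproduct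

/-- `∑_k t_{ik} ⊗ t_{kj}`. -/
def dt (n : ℕ) (q : K) (i j : Fin (2 * n + 1)) : A n q ⊗[K] A n q :=
  ∑ k, t n q i k ⊗ₜ[K] t n q k j

theorem dt_rel (n : ℕ) {q : K} (hq : q ≠ 0)
    ⦃f g : FreeAlgebra K (Fin (2 * n + 1) × Fin (2 * n + 1))⦄ (h : Rel n q f g) :
    FreeAlgebra.lift K (fun ij => dt n q ij.1 ij.2) f =
      FreeAlgebra.lift K (fun ij => dt n q ij.1 ij.2) g := by
  generalize hF : FreeAlgebra.lift K
    (fun ij : Fin (2 * n + 1) × Fin (2 * n + 1) => dt n q ij.1 ij.2) = F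
  have hx : ∀ i j, F (x K n i j) = dt n q i j := by
    intro i j
    rw [← hF, x, FreeAlgebra.lift_ι_apply]
  cases h with
  | rtt i j k l =>
    simp only [map_sum, map_smul, map_mul, hx]
    exact dt_rtt (rtt n q) i j k l
  | orth_left i m =>
    rw [apply_ite F, map_one, map_zero]
    simp only [map_sum, map_smul, map_mul, hx]
    exact dt_left (C_mul_C n hq) (orth_left n q) i m
  | orth_right i m =>
    rw [apply_ite F, map_one, map_zero]
    simp only [map_sum, map_smul, map_mul, hx]
    exact dt_right (C_mul_C n hq) (orth_right n q) i m

/-- The coproduct `Δ(t_{ij}) = ∑_k t_{ik} ⊗ t_{kj}`. -/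
def comul (n : ℕ) {q : K} (hq : q ≠ 0) : A n q →ₐ[K] A n q ⊗[K] A n q :=
  RingQuot.liftAlgHom K ⟨FreeAlgebra.lift K fun ij => dt n q ij.1 ij.2, dt_rel n hq⟩

theorem comul_t (n : ℕ) {q : K} (hq : q ≠ 0) (i j : Fin (2 * n + 1)) :
    comul n hq (t n q i j) = ∑ k, t n q i k ⊗ₜ[K] t n q k j := by
  simp [comul, t, x, dt, RingQuot.liftAlgHom_mkAlgHom_apply]

/-- The tensor product of two representations, through the coproduct. -/
def tensorRep (n : ℕ) {q : K} (hq : q ≠ 0) {V W : Type*} [AddCommGroup V] [Module K V]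
    [AddCommGroup W] [Module K W] (ρ : A n q →ₐ[K] Module.End K V)
    (τ : A n q →ₐ[K] Module.End K W) : A n q →ₐ[K] Module.End K (V ⊗[K] W) :=
  (Module.endTensorEndAlgHom (R := K) (S := K) (A := K) (M := V) (N := W)).comp
    ((Algebra.TensorProduct.map ρ τ).comp (comul n hq))

/-! ## The q-oscillator algebra and its Fock representation -/

/-- The generators `a⁺, a⁻, k`. -/
inductive OscGen : Type
  | ap
  | am
  | k

/-- The relations of the `p`-oscillator algebra. -/
inductive OscRel (p : K) : FreeAlgebra K OscGen → FreeAlgebra K OscGen → Prop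
  | k_ap : OscRel p (FreeAlgebra.ι K OscGen.k * FreeAlgebra.ι K OscGen.ap)
      (p • (FreeAlgebra.ι K OscGen.ap * FreeAlgebra.ι K OscGen.k))
  | k_am : OscRel p (FreeAlgebra.ι K OscGen.k * FreeAlgebra.ι K OscGen.am)
      (p⁻¹ • (FreeAlgebra.ι K OscGen.am * FreeAlgebra.ι K OscGen.k))
  | am_ap : OscRel p (FreeAlgebra.ι K OscGen.am * FreeAlgebra.ι K OscGen.ap)
      (1 - p ^ 2 • FreeAlgebra.ι K OscGen.k ^ 2)
  | ap_am : OscRel p (FreeAlgebra.ι K OscGen.ap * FreeAlgebra.ι K OscGen.am)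
      (1 - FreeAlgebra.ι K OscGen.k ^ 2)

/-- The `p`-oscillator algebra `Osc_p`. -/
abbrev Osc (p : K) : Type _ := RingQuot (OscRel p)

/-- The generator `a⁺` of `Osc_p`. -/
def Osc.ap (p : K) : Osc p := RingQuot.mkAlgHom K (OscRel p) (FreeAlgebra.ι K OscGen.ap)

/-- The generator `a⁻` of `Osc_p`. -/
def Osc.am (p : K) : Osc p := RingQuot.mkAlgHom K (OscRel p) (FreeAlgebra.ι K OscGen.am)

/-- The generator `k` of `Osc_p`. -/
def Osc.k (p : K) : Osc p := RingQuot.mkAlgHom K (OscRel p) (FreeAlgebra.ι K OscGen.k)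

/-- The Fock space with basis `|0⟩, |1⟩, |2⟩, …`. -/
abbrev Fock (K : Type*) [Field K] : Type _ := ℕ →₀ K

/-- The basis vector `|m⟩`. -/
def ket (K : Type*) [Field K] (m : ℕ) : Fock K := Finsupp.single m 1

/-- `a⁺ |m⟩ = |m+1⟩`, `a⁻ |m⟩ = (1 - p^{2m}) |m-1⟩` (zero for `m = 0`), `k |m⟩ = p^m |m⟩`. -/
def fockOp (p : K) : OscGen → Module.End K (Fock K)
  | OscGen.ap => Finsupp.linearCombination K fun m => ket K (m + 1)
  | OscGen.am => Finsupp.linearCombination K fun m => (1 - p ^ (2 * m)) • ket K (m - 1)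
  | OscGen.k => Finsupp.linearCombination K fun m => p ^ m • ket K m

theorem fockOp_ap (p : K) (m : ℕ) : fockOp p OscGen.ap (ket K m) = ket K (m + 1) := by
  simp [fockOp, ket]

theorem fockOp_am (p : K) (m : ℕ) :
    fockOp p OscGen.am (ket K m) = (1 - p ^ (2 * m)) • ket K (m - 1) := by
  simp [fockOp, ket]

theorem fockOp_k (p : K) (m : ℕ) : fockOp p OscGen.k (ket K m) = p ^ m • ket K m := by
  simp [fockOp, ket]

theorem end_ext {f g : Module.End K (Fock K)} (h : ∀ m, f (ket K m) = g (ket K m)) : f = g := by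
  refine Finsupp.lhom_ext' fun m => LinearMap.ext_ring ?_
  exact h m

/-- The representation of `Osc_p` on the Fock space. -/
def fockRep {p : K} (hp : p ≠ 0) : Osc p →ₐ[K] Module.End K (Fock K) :=
  RingQuot.liftAlgHom K ⟨FreeAlgebra.lift K (fockOp p), by
    intro f g h
    cases h <;> refine end_ext fun m => ?_
    · simp [fockOp_ap, fockOp_k, pow_succ, smul_smul, mul_comm]
    · cases m with
      | zero => simp [fockOp_am, fockOp_k]
      | succ m =>
        simp only [map_mul, map_smul, FreeAlgebra.lift_ι_apply, Module.End.mul_apply,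
          LinearMap.smul_apply, fockOp_am, fockOp_k, smul_smul, Nat.add_sub_cancel]
        congr 1
        field_simp
        ring
    · simp only [map_mul, map_smul, map_sub, map_one, FreeAlgebra.lift_ι_apply,
        Module.End.mul_apply, pow_two, Module.End.one_apply, LinearMap.sub_apply,
        LinearMap.smul_apply, fockOp_am, fockOp_ap, fockOp_k, smul_smul, Nat.add_sub_cancel]
      rw [sub_smul, one_smul]
      congr 2
      ring
    · cases m with
      | zero => simp [fockOp_am, fockOp_k, pow_two]
      | succ m =>
        simp only [map_mul, map_smul, map_sub, map_one, FreeAlgebra.lift_ι_apply,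
          Module.End.mul_apply, pow_two, Module.End.one_apply, LinearMap.sub_apply,
          fockOp_am, fockOp_ap, fockOp_k, smul_smul, Nat.add_sub_cancel]
        rw [sub_smul, one_smul]
        congr 2
        ring⟩

/-! ## The fundamental representations `π₁`, `π₂` of `A_q(B_3)` -/

/-- The parameters entering `π₁` or `π₂`. -/
structure Param (K : Type*) where
  α : K
  β : K
  μ : K
  ν : K
  σ : K
  κ : K

/-- The parameters are nonzero and `α β = -q² μ ν`, `σ = ±1`. -/
structure Param.Admissible (q : K) (c : Param K) : Prop where
  α_ne : c.α ≠ 0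
  β_ne : c.β ≠ 0
  μ_ne : c.μ ≠ 0
  ν_ne : c.ν ≠ 0
  κ_ne : c.κ ≠ 0
  mul_eq : c.α * c.β = -q ^ 2 * c.μ * c.ν
  σ_eq : c.σ = 1 ∨ c.σ = -1

open Osc in
/-- The images of the generators `t_{ij}` under `π₁`, in `Osc_{q²}`. -/
def pi₁Matrix (q : K) (c : Param K) : Matrix (Fin 7) (Fin 7) (Osc (q ^ 2)) :=
  !![c.μ • am (q ^ 2), c.α • k (q ^ 2), 0, 0, 0, 0, 0;
     c.β • k (q ^ 2), c.ν • ap (q ^ 2), 0, 0, 0, 0, 0;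
     0, 0, c.κ • 1, 0, 0, 0, 0;
     0, 0, 0, c.σ • 1, 0, 0, 0;
     0, 0, 0, 0, c.κ⁻¹ • 1, 0, 0;
     0, 0, 0, 0, 0, c.ν⁻¹ • am (q ^ 2), (q ^ 2 * c.β⁻¹) • k (q ^ 2);
     0, 0, 0, 0, 0, (q ^ 2 * c.α⁻¹) • k (q ^ 2), c.μ⁻¹ • ap (q ^ 2)]

open Osc in
/-- The images of the generators `t_{ij}` under `π₂`, in `Osc_{q²}`. -/
def pi₂Matrix (q : K) (c : Param K) : Matrix (Fin 7) (Fin 7) (Osc (q ^ 2)) :=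
  !![c.κ • 1, 0, 0, 0, 0, 0, 0;
     0, c.μ • am (q ^ 2), c.α • k (q ^ 2), 0, 0, 0, 0;
     0, c.β • k (q ^ 2), c.ν • ap (q ^ 2), 0, 0, 0, 0;
     0, 0, 0, c.σ • 1, 0, 0, 0;
     0, 0, 0, 0, c.ν⁻¹ • am (q ^ 2), (q ^ 2 * c.β⁻¹) • k (q ^ 2), 0;
     0, 0, 0, 0, (q ^ 2 * c.α⁻¹) • k (q ^ 2), c.μ⁻¹ • ap (q ^ 2), 0;
     0, 0, 0, 0, 0, 0, c.κ⁻¹ • 1]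

/-- The representation on the Fock space given by an algebra homomorphism to `Osc_{q²}`. -/
def onFock {q : K} (hq : q ≠ 0) (π : A 3 q →ₐ[K] Osc (q ^ 2)) :
    A 3 q →ₐ[K] Module.End K (Fock K) :=
  (fockRep (pow_ne_zero 2 hq)).comp π

/-! ## Three-fold tensor products and matrix elements -/

/-- The three-fold tensor product of the Fock space. -/
abbrev Fock3 (K : Type*) [Field K] : Type _ := Fock K ⊗[K] Fock K ⊗[K] Fock K

/-- `π_{abc} = π_a ⊗ π_b ⊗ π_c`, acting on the three-fold tensor product of the Fock space through
the iterated coproduct. -/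
def tripleRep {q : K} (hq : q ≠ 0) (πa πb πc : A 3 q →ₐ[K] Osc (q ^ 2)) :
    A 3 q →ₐ[K] Module.End K (Fock3 K) :=
  tensorRep 3 hq (tensorRep 3 hq (onFock hq πa) (onFock hq πb)) (onFock hq πc)

/-- `|i⟩ ⊗ |j⟩ ⊗ |k⟩`. -/
def ket3 (K : Type*) [Field K] (i j k : ℕ) : Fock3 K := ket K i ⊗ₜ[K] ket K j ⊗ₜ[K] ket K k

/-- `P₁₃ (x ⊗ y ⊗ z) = z ⊗ y ⊗ x`. -/
def P₁₃ (K : Type*) [Field K] : Module.End K (Fock3 K) :=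
  ((TensorProduct.comm K (Fock K ⊗[K] Fock K) (Fock K)).trans
    ((TensorProduct.congr (LinearEquiv.refl K (Fock K))
      (TensorProduct.comm K (Fock K) (Fock K))).trans
      (TensorProduct.assoc K (Fock K) (Fock K) (Fock K)).symm)).toLinearMap

theorem P₁₃_tmul (x y z : Fock K) :
    P₁₃ K (x ⊗ₜ[K] y ⊗ₜ[K] z) = z ⊗ₜ[K] y ⊗ₜ[K] x := by
  simp [P₁₃]

/-- The basis `|a⟩ ⊗ |b⟩ ⊗ |c⟩`, indexed by `((a, b), c)`. -/
def basis3 (K : Type*) [Field K] : Module.Basis ((ℕ × ℕ) × ℕ) K (Fock3 K) :=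
  ((Finsupp.basisSingleOne (R := K) (ι := ℕ)).tensorProduct Finsupp.basisSingleOne).tensorProduct
    Finsupp.basisSingleOne

theorem basis3_apply (a b c : ℕ) : basis3 K ((a, b), c) = ket3 K a b c := by
  simp [basis3, ket3, ket]

/-- The coefficient `S^{abc}_{ijk}` of `|a⟩ ⊗ |b⟩ ⊗ |c⟩` in `S (|i⟩ ⊗ |j⟩ ⊗ |k⟩)`. -/
def matrixElement (S : Module.End K (Fock3 K)) (a b c i j k : ℕ) : K :=
  (basis3 K).repr (S (ket3 K i j k)) ((a, b), c)

/-- `Φ` is a normalized intertwiner from `π_{121}` to `π_{212}`. -/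
structure IsNormalizedIntertwiner {q : K} (hq : q ≠ 0) (π₁ π₂ : A 3 q →ₐ[K] Osc (q ^ 2))
    (Φ : Module.End K (Fock3 K)) : Prop where
  intertwines : ∀ f : A 3 q, tripleRep hq π₂ π₁ π₂ f ∘ₗ Φ = Φ ∘ₗ tripleRep hq π₁ π₂ π₁ f
  normalized : Φ (ket3 K 0 0 0) = ket3 K 0 0 0

/-! ## The explicit formula -/

/-- `(p)_i = ∏_{j=1}^i (1 - p^j)`. -/
def qPoch (p : K) (i : ℕ) : K := ∏ j ∈ Finset.Icc 1 i, (1 - p ^ j)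

/-- `∏ (p)_{i_k} / ∏ (p)_{j_k}` if all the integers in the two lists are nonnegative, and `0`
otherwise. -/
def qBracket (p : K) (num den : List ℤ) : K :=
  if (∀ i ∈ num, 0 ≤ i) ∧ (∀ j ∈ den, 0 ≤ j) then
    (num.map fun i => qPoch p i.toNat).prod / (den.map fun j => qPoch p j.toNat).prod
  else 0

/-- The matrix elements of `𝒮`; the summation variable is the pair `(λ, μ)`, `λ + μ = b`. -/
def scrS (q : K) (a b c i j k : ℕ) : K :=
  if i + j = a + b ∧ j + k = b + c then
    ∑ s ∈ Finset.HasAntidiagonal.antidiagonal b, (-1) ^ s.1 *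
      q ^ (2 * (i : ℤ) * ((c : ℤ) - j) + 2 * ((k : ℤ) + 1) * s.1 + 2 * (s.2 : ℤ) * ((s.2 : ℤ) - k)) *
      qBracket (q ^ 4) [(i : ℤ), (j : ℤ), (c : ℤ) + s.2]
        [(s.2 : ℤ), (s.1 : ℤ), (i : ℤ) - s.2, (j : ℤ) - s.1, (c : ℤ)]
  else 0

/-- The matrix elements of the 3D R matrix with parameter `p`; the summation variable is the pair
`(λ, μ)`, `λ + μ = b`. -/
def scrR (p : K) (a b c i j k : ℕ) : K :=
  if i + j = a + b ∧ j + k = b + c then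
    ∑ s ∈ Finset.HasAntidiagonal.antidiagonal b, (-1) ^ s.1 *
      p ^ ((i : ℤ) * ((c : ℤ) - j) + ((k : ℤ) + 1) * s.1 + (s.2 : ℤ) * ((s.2 : ℤ) - k)) *
      qBracket (p ^ 2) [(i : ℤ), (j : ℤ), (c : ℤ) + s.2]
        [(s.2 : ℤ), (s.1 : ℤ), (i : ℤ) - s.2, (j : ℤ) - s.1, (c : ℤ)]
  else 0

end QFunB

end

noncomputable section

namespace QFunB

variable {K : Type*} [Field K]

/-! ### The defining relations with their sums carried out. -/

section Orthogonality

variable {B : Type*} [Semiring B] [Algebra K B]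

/-! The matrices defining π₁ and π₂ are block diagonal for the index blocks {1,2,3}, {4}, {5,6,7}.
No two indices in {1,2,3} are dual, so among them the type B relations reduce to those of the
quantum matrix algebra M_{q²}(3) (`isQuantumMatrix_of_rtt`); the upper blocks are diag(M, κ) for π₁
and diag(κ, M) for π₂. The problem is thus the type A₂ one, whose solution is the 3D R matrix.

Let X be the upper block of π₁₂₁ and Y that of π₂₁₂. On Fock space X₃₂, X₃₃, X₂₃ each raise a single
tensor factor, so the monomials X₃₂ⁱ X₃₃ʲ X₂₃ᵏ take the vacuum to nonzero multiples of |k⟩⊗|j⟩⊗|i⟩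
(`mono_AB`). The vacuum is therefore cyclic, an intertwiner is determined by its value there
(`intertwiner_ext`), and the only candidate for Φ sends each X-monomial on the vacuum to the same
Y-monomial on the vacuum (`blockIntertwiner`). The candidate works because the other six entries act
on the vacuum by the same scalars on both sides (`tripleBlock_vacuum`), and the quadratic relations
carry every entry through a monomial down to the vacuum (`intertwine_of_mono`).

The orthogonality relations express the lower block {5,6,7} through the inverse of the upper one, so
intertwining the upper block implies intertwining the lower one (`intertwine_dual`); the middle
entry is the same scalar on both sides.

For bijectivity, in the lower blocks the two shapes are exchanged: π₂₁₂ now has the form in which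
the vacuum is cyclic. The same construction with dual parameters yields an intertwiner Φ' in the
opposite direction, and both composites fix a cyclic vacuum, so they are identities.

The matrix elements come from expanding the Y-monomials. Y₃₃ and Y₃₂ are sums of two terms that
commute up to a power of q on the relevant vectors, so their powers expand with q⁴-binomial
coefficients; weight conservation reduces the resulting double sum to the sum over λ+μ=b
(`matrixElement_blockIntertwiner`). -/

theorem sum_C_left (n : ℕ) {q : K} (hq : q ≠ 0) (T : Fin (2 * n + 1) → Fin (2 * n + 1) → B)
    (i m : Fin (2 * n + 1)) :
    ∑ j, ∑ k, ∑ l, (C n q j k * C n q l m) • (T i j * T l k) =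
      ∑ j, q ^ (rho n m - rho n j) • (T i j * T (Fin.rev m) (Fin.rev j)) := by
  refine Finset.sum_congr rfl fun j _ => ?_
  rw [Finset.sum_eq_single (Fin.rev j), Finset.sum_eq_single (Fin.rev m)]
  · simp only [C, Fin.rev_rev, if_true]
    rw [← zpow_add₀ hq, rho_rev]
    congr 2
    ring
  · intro l _ hl; simp [C, hl]
  · simp
  · intro k _ hk
    have : j ≠ Fin.rev k := fun h => hk (by rw [h, Fin.rev_rev])
    simp [C, this]
  · simp

theorem sum_C_right (n : ℕ) {q : K} (hq : q ≠ 0) (T : Fin (2 * n + 1) → Fin (2 * n + 1) → B)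
    (i m : Fin (2 * n + 1)) :
    ∑ j, ∑ k, ∑ l, (C n q i j * C n q k l) • (T k j * T l m) =
      ∑ l, q ^ (rho n l - rho n i) • (T (Fin.rev l) (Fin.rev i) * T l m) := by
  rw [Finset.sum_eq_single (Fin.rev i), Finset.sum_comm]
  · refine Finset.sum_congr rfl fun l _ => ?_
    rw [Finset.sum_eq_single (Fin.rev l)]
    · simp only [C, Fin.rev_rev, if_true]
      rw [← zpow_add₀ hq, rho_rev]
      congr 2
      ring
    · intro l _ hl; simp [C, hl]
    · simp
  · intro k _ hk
    have : i ≠ Fin.rev k := fun h => hk (by rw [h, Fin.rev_rev])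
    simp [C, this]
  · simp

end Orthogonality

section Relations

variable {B : Type*} [Ring B] [Algebra K B]

/-- The entries of R are of three kinds: diagonal ones and flips, which fix (m, p), and those
between dual pairs, which only force p = m' and leave a sum over m. -/
theorem sum_R_left (n : ℕ) (q : K) (T : Fin (2 * n + 1) → Fin (2 * n + 1) → B)
    (i j k l : Fin (2 * n + 1)) :
    ∑ m, ∑ p, R n q i j m p • (T m k * T p l) =
      (if i = j then (if i = Fin.rev i then 1 else q ^ (2 : ℤ))
        else if j = Fin.rev i then q ^ (-2 : ℤ) else 1 : K) • (T i k * T j l)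
      + (if j < i then (q ^ (2 : ℤ) - q ^ (-2 : ℤ)) • (T j k * T i l) else 0)
      - (if j = Fin.rev i then ∑ m, if m < i then
          ((q ^ (2 : ℤ) - q ^ (-2 : ℤ)) * q ^ (rho n i - rho n m)) • (T m k * T (Fin.rev m) l)
          else 0 else 0) := by
  simp only [R, sub_smul, add_smul, Finset.sum_sub_distrib, Finset.sum_add_distrib]
  congr 1
  · congr 1
    · rw [Finset.sum_eq_single i, Finset.sum_eq_single j]
      · simp
      · intro b _ hb; simp [hb.symm]
      · simp
      · intro b _ hb; simp [hb.symm]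
      · simp
    · rw [Finset.sum_eq_single j, Finset.sum_eq_single i]
      · by_cases h : j < i <;> simp [h, sub_smul]
      · intro b _ hb; simp [hb.symm]
      · simp
      · intro b _ hb; simp [hb.symm]
      · simp
  · by_cases h : j = Fin.rev i
    · simp only [h, true_and, if_true]
      refine Finset.sum_congr rfl fun m _ => ?_
      rw [Finset.sum_eq_single (Fin.rev m)]
      · by_cases h : m < i <;> simp [h]
      · intro b _ hb; simp [hb]
      · simp
    · simp [h]

theorem sum_R_right (n : ℕ) (q : K) (T : Fin (2 * n + 1) → Fin (2 * n + 1) → B)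
    (i j k l : Fin (2 * n + 1)) :
    ∑ m, ∑ p, R n q m p k l • (T j p * T i m) =
      (if k = l then (if k = Fin.rev k then 1 else q ^ (2 : ℤ))
        else if l = Fin.rev k then q ^ (-2 : ℤ) else 1 : K) • (T j l * T i k)
      + (if k < l then (q ^ (2 : ℤ) - q ^ (-2 : ℤ)) • (T j k * T i l) else 0)
      - (if l = Fin.rev k then ∑ m, if k < m then
          ((q ^ (2 : ℤ) - q ^ (-2 : ℤ)) * q ^ (rho n m - rho n k)) • (T j (Fin.rev m) * T i m)
          else 0 else 0) := by
  simp only [R, sub_smul, add_smul, Finset.sum_sub_distrib, Finset.sum_add_distrib]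
  congr 1
  · congr 1
    · rw [Finset.sum_eq_single k, Finset.sum_eq_single l]
      · simp
      · intro b _ hb; simp [hb]
      · simp
      · intro b _ hb; simp [hb]
      · simp
    · rw [Finset.sum_eq_single l, Finset.sum_eq_single k]
      · by_cases h : k < l <;> simp [h, sub_smul]
      · intro b _ hb; simp [hb]
      · simp
      · intro b _ hb; simp [hb]
      · simp
  · by_cases h : l = Fin.rev k
    · simp only [h, true_and, if_true]
      refine Finset.sum_congr rfl fun m _ => ?_
      rw [Finset.sum_eq_single (Fin.rev m)]
      · by_cases h : k < m <;> simp [h]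
      · intro b _ hb; simp [hb]
      · simp
    · simp [h]

/-- A matrix satisfying the defining relations of `A_q(B_n)` defines an algebra homomorphism. -/
theorem exists_algHom (n : ℕ) {q : K} (hq : q ≠ 0) (T : Fin (2 * n + 1) → Fin (2 * n + 1) → B)
    (hR : ∀ i j k l : Fin (2 * n + 1),
      (if i = j then (if i = Fin.rev i then 1 else q ^ (2 : ℤ))
        else if j = Fin.rev i then q ^ (-2 : ℤ) else 1 : K) • (T i k * T j l)
      + (if j < i then (q ^ (2 : ℤ) - q ^ (-2 : ℤ)) • (T j k * T i l) else 0)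
      - (if j = Fin.rev i then ∑ m, if m < i then
          ((q ^ (2 : ℤ) - q ^ (-2 : ℤ)) * q ^ (rho n i - rho n m)) • (T m k * T (Fin.rev m) l)
          else 0 else 0) =
      (if k = l then (if k = Fin.rev k then 1 else q ^ (2 : ℤ))
        else if l = Fin.rev k then q ^ (-2 : ℤ) else 1 : K) • (T j l * T i k)
      + (if k < l then (q ^ (2 : ℤ) - q ^ (-2 : ℤ)) • (T j k * T i l) else 0)
      - (if l = Fin.rev k then ∑ m, if k < m then
          ((q ^ (2 : ℤ) - q ^ (-2 : ℤ)) * q ^ (rho n m - rho n k)) • (T j (Fin.rev m) * T i m)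
          else 0 else 0))
    (hl : ∀ i m, ∑ j, q ^ (rho n m - rho n j) • (T i j * T (Fin.rev m) (Fin.rev j)) =
      if i = m then 1 else 0)
    (hr : ∀ i m, ∑ l, q ^ (rho n l - rho n i) • (T (Fin.rev l) (Fin.rev i) * T l m) =
      if i = m then 1 else 0) :
    ∃ π : A n q →ₐ[K] B, ∀ i j, π (t n q i j) = T i j := by
  have key : ∀ ⦃f g : FreeAlgebra K (Fin (2 * n + 1) × Fin (2 * n + 1))⦄, Rel n q f g →
      FreeAlgebra.lift K (fun ij : Fin (2 * n + 1) × Fin (2 * n + 1) => T ij.1 ij.2) f =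
      FreeAlgebra.lift K (fun ij : Fin (2 * n + 1) × Fin (2 * n + 1) => T ij.1 ij.2) g := by
    intro f g h
    generalize hF : FreeAlgebra.lift K
      (fun ij : Fin (2 * n + 1) × Fin (2 * n + 1) => T ij.1 ij.2) = F
    have hx : ∀ i j, F (x K n i j) = T i j := by
      intro i j
      rw [← hF, x, FreeAlgebra.lift_ι_apply]
    cases h with
    | rtt i j k l =>
      simp only [map_sum, map_smul, map_mul, hx]
      rw [sum_R_left, sum_R_right, hR]
    | orth_left i m =>
      rw [apply_ite F, map_one, map_zero]
      simp only [map_sum, map_smul, map_mul, hx]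
      rw [sum_C_left n hq, hl]
    | orth_right i m =>
      rw [apply_ite F, map_one, map_zero]
      simp only [map_sum, map_smul, map_mul, hx]
      rw [sum_C_right n hq, hr]
  exact ⟨RingQuot.liftAlgHom K ⟨_, key⟩, fun i j => by
    simp [t, x, RingQuot.liftAlgHom_mkAlgHom_apply]⟩

end Relations

/-! ### Existence of π₁ and π₂. -/

section FundamentalRepresentations

namespace Osc

theorem k_mul_ap (p : K) : k p * ap p = p • (ap p * k p) := by
  have h := RingQuot.mkAlgHom_rel K (OscRel.k_ap (p := p))
  simp only [map_mul, map_smul] at h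
  exact h

theorem k_mul_am (p : K) : k p * am p = p⁻¹ • (am p * k p) := by
  have h := RingQuot.mkAlgHom_rel K (OscRel.k_am (p := p))
  simp only [map_mul, map_smul] at h
  exact h

theorem am_mul_ap (p : K) : am p * ap p = 1 - p ^ 2 • (k p * k p) := by
  have h := RingQuot.mkAlgHom_rel K (OscRel.am_ap (p := p))
  simp only [map_mul, map_smul, map_sub, map_one, pow_two (FreeAlgebra.ι K OscGen.k)] at h
  exact h

theorem ap_mul_am (p : K) : ap p * am p = 1 - k p * k p := by
  have h := RingQuot.mkAlgHom_rel K (OscRel.ap_am (p := p))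
  simp only [map_mul, map_sub, map_one, pow_two (FreeAlgebra.ι K OscGen.k)] at h
  exact h

end Osc

theorem forall_fin_seven {P : Fin 7 → Prop} :
    (∀ i, P i) ↔ P 0 ∧ P 1 ∧ P 2 ∧ P 3 ∧ P 4 ∧ P 5 ∧ P 6 :=
  ⟨fun h => ⟨h _, h _, h _, h _, h _, h _, h _⟩, by
    rintro ⟨h0, h1, h2, h3, h4, h5, h6⟩ i
    fin_cases i <;> assumption⟩

open Osc

theorem pi₁Matrix_apply (q : K) (c : Param K) :
    pi₁Matrix q c 0 0 = c.μ • am (q ^ 2) ∧ pi₁Matrix q c 0 1 = c.α • k (q ^ 2) ∧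
    pi₁Matrix q c 0 2 = 0 ∧ pi₁Matrix q c 0 3 = 0 ∧ pi₁Matrix q c 0 4 = 0 ∧ pi₁Matrix q c 0 5 = 0 ∧
    pi₁Matrix q c 0 6 = 0 ∧
    pi₁Matrix q c 1 0 = c.β • k (q ^ 2) ∧ pi₁Matrix q c 1 1 = c.ν • ap (q ^ 2) ∧
    pi₁Matrix q c 1 2 = 0 ∧ pi₁Matrix q c 1 3 = 0 ∧ pi₁Matrix q c 1 4 = 0 ∧ pi₁Matrix q c 1 5 = 0 ∧
    pi₁Matrix q c 1 6 = 0 ∧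
    pi₁Matrix q c 2 0 = 0 ∧ pi₁Matrix q c 2 1 = 0 ∧ pi₁Matrix q c 2 2 = c.κ • 1 ∧
    pi₁Matrix q c 2 3 = 0 ∧ pi₁Matrix q c 2 4 = 0 ∧ pi₁Matrix q c 2 5 = 0 ∧ pi₁Matrix q c 2 6 = 0 ∧
    pi₁Matrix q c 3 0 = 0 ∧ pi₁Matrix q c 3 1 = 0 ∧ pi₁Matrix q c 3 2 = 0 ∧
    pi₁Matrix q c 3 3 = c.σ • 1 ∧ pi₁Matrix q c 3 4 = 0 ∧ pi₁Matrix q c 3 5 = 0 ∧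
    pi₁Matrix q c 3 6 = 0 ∧
    pi₁Matrix q c 4 0 = 0 ∧ pi₁Matrix q c 4 1 = 0 ∧ pi₁Matrix q c 4 2 = 0 ∧ pi₁Matrix q c 4 3 = 0 ∧
    pi₁Matrix q c 4 4 = c.κ⁻¹ • 1 ∧ pi₁Matrix q c 4 5 = 0 ∧ pi₁Matrix q c 4 6 = 0 ∧
    pi₁Matrix q c 5 0 = 0 ∧ pi₁Matrix q c 5 1 = 0 ∧ pi₁Matrix q c 5 2 = 0 ∧ pi₁Matrix q c 5 3 = 0 ∧
    pi₁Matrix q c 5 4 = 0 ∧ pi₁Matrix q c 5 5 = c.ν⁻¹ • am (q ^ 2) ∧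
    pi₁Matrix q c 5 6 = (q ^ 2 * c.β⁻¹) • k (q ^ 2) ∧
    pi₁Matrix q c 6 0 = 0 ∧ pi₁Matrix q c 6 1 = 0 ∧ pi₁Matrix q c 6 2 = 0 ∧ pi₁Matrix q c 6 3 = 0 ∧
    pi₁Matrix q c 6 4 = 0 ∧ pi₁Matrix q c 6 5 = (q ^ 2 * c.α⁻¹) • k (q ^ 2) ∧
    pi₁Matrix q c 6 6 = c.μ⁻¹ • ap (q ^ 2) := by
  refine ⟨?_, ?_, ?_, ?_, ?_, ?_, ?_, ?_, ?_, ?_, ?_, ?_, ?_, ?_, ?_, ?_, ?_, ?_, ?_, ?_, ?_, ?_,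
    ?_, ?_, ?_, ?_, ?_, ?_, ?_, ?_, ?_, ?_, ?_, ?_, ?_, ?_, ?_, ?_, ?_, ?_, ?_, ?_, ?_, ?_, ?_,
    ?_, ?_, ?_, ?_⟩ <;> rfl

theorem pi₂Matrix_apply (q : K) (c : Param K) :
    pi₂Matrix q c 0 0 = c.κ • 1 ∧ pi₂Matrix q c 0 1 = 0 ∧ pi₂Matrix q c 0 2 = 0 ∧
    pi₂Matrix q c 0 3 = 0 ∧ pi₂Matrix q c 0 4 = 0 ∧ pi₂Matrix q c 0 5 = 0 ∧ pi₂Matrix q c 0 6 = 0 ∧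
    pi₂Matrix q c 1 0 = 0 ∧ pi₂Matrix q c 1 1 = c.μ • am (q ^ 2) ∧
    pi₂Matrix q c 1 2 = c.α • k (q ^ 2) ∧ pi₂Matrix q c 1 3 = 0 ∧ pi₂Matrix q c 1 4 = 0 ∧
    pi₂Matrix q c 1 5 = 0 ∧ pi₂Matrix q c 1 6 = 0 ∧
    pi₂Matrix q c 2 0 = 0 ∧ pi₂Matrix q c 2 1 = c.β • k (q ^ 2) ∧
    pi₂Matrix q c 2 2 = c.ν • ap (q ^ 2) ∧ pi₂Matrix q c 2 3 = 0 ∧ pi₂Matrix q c 2 4 = 0 ∧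
    pi₂Matrix q c 2 5 = 0 ∧ pi₂Matrix q c 2 6 = 0 ∧
    pi₂Matrix q c 3 0 = 0 ∧ pi₂Matrix q c 3 1 = 0 ∧ pi₂Matrix q c 3 2 = 0 ∧
    pi₂Matrix q c 3 3 = c.σ • 1 ∧ pi₂Matrix q c 3 4 = 0 ∧ pi₂Matrix q c 3 5 = 0 ∧
    pi₂Matrix q c 3 6 = 0 ∧
    pi₂Matrix q c 4 0 = 0 ∧ pi₂Matrix q c 4 1 = 0 ∧ pi₂Matrix q c 4 2 = 0 ∧ pi₂Matrix q c 4 3 = 0 ∧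
    pi₂Matrix q c 4 4 = c.ν⁻¹ • am (q ^ 2) ∧ pi₂Matrix q c 4 5 = (q ^ 2 * c.β⁻¹) • k (q ^ 2) ∧
    pi₂Matrix q c 4 6 = 0 ∧
    pi₂Matrix q c 5 0 = 0 ∧ pi₂Matrix q c 5 1 = 0 ∧ pi₂Matrix q c 5 2 = 0 ∧ pi₂Matrix q c 5 3 = 0 ∧
    pi₂Matrix q c 5 4 = (q ^ 2 * c.α⁻¹) • k (q ^ 2) ∧ pi₂Matrix q c 5 5 = c.μ⁻¹ • ap (q ^ 2) ∧
    pi₂Matrix q c 5 6 = 0 ∧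
    pi₂Matrix q c 6 0 = 0 ∧ pi₂Matrix q c 6 1 = 0 ∧ pi₂Matrix q c 6 2 = 0 ∧ pi₂Matrix q c 6 3 = 0 ∧
    pi₂Matrix q c 6 4 = 0 ∧ pi₂Matrix q c 6 5 = 0 ∧ pi₂Matrix q c 6 6 = c.κ⁻¹ • 1 := by
  refine ⟨?_, ?_, ?_, ?_, ?_, ?_, ?_, ?_, ?_, ?_, ?_, ?_, ?_, ?_, ?_, ?_, ?_, ?_, ?_, ?_, ?_, ?_,
    ?_, ?_, ?_, ?_, ?_, ?_, ?_, ?_, ?_, ?_, ?_, ?_, ?_, ?_, ?_, ?_, ?_, ?_, ?_, ?_, ?_, ?_, ?_,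
    ?_, ?_, ?_, ?_⟩ <;> rfl

theorem rho_three : rho 3 0 = 5 ∧ rho 3 1 = 3 ∧ rho 3 2 = 1 ∧ rho 3 3 = 0 ∧ rho 3 4 = -1 ∧
    rho 3 5 = -3 ∧ rho 3 6 = -5 := ⟨rfl, rfl, rfl, rfl, rfl, rfl, rfl⟩

theorem rev_seven : Fin.rev (0 : Fin 7) = 6 ∧ Fin.rev (1 : Fin 7) = 5 ∧ Fin.rev (2 : Fin 7) = 4 ∧
    Fin.rev (3 : Fin 7) = 3 ∧ Fin.rev (4 : Fin 7) = 2 ∧ Fin.rev (5 : Fin 7) = 1 ∧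
    Fin.rev (6 : Fin 7) = 0 := ⟨rfl, rfl, rfl, rfl, rfl, rfl, rfl⟩

/-- The RTT relation of type `B_3` with the sums over the R matrix carried out. -/
def RTTThree {B : Type*} [Ring B] [Algebra K B] (q : K) (T : Fin 7 → Fin 7 → B)
    (i j k l : Fin 7) : Prop :=
  (if i = j then (if i = Fin.rev i then 1 else q ^ (2 : ℤ))
    else if j = Fin.rev i then q ^ (-2 : ℤ) else 1 : K) • (T i k * T j l)
  + (if j < i then (q ^ (2 : ℤ) - q ^ (-2 : ℤ)) • (T j k * T i l) else 0)
  - (if j = Fin.rev i then ∑ m : Fin 7, if m < i then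
      ((q ^ (2 : ℤ) - q ^ (-2 : ℤ)) * q ^ (rho 3 i - rho 3 m)) • (T m k * T (Fin.rev m) l)
      else 0 else 0) =
  (if k = l then (if k = Fin.rev k then 1 else q ^ (2 : ℤ))
    else if l = Fin.rev k then q ^ (-2 : ℤ) else 1 : K) • (T j l * T i k)
  + (if k < l then (q ^ (2 : ℤ) - q ^ (-2 : ℤ)) • (T j k * T i l) else 0)
  - (if l = Fin.rev k then ∑ m : Fin 7, if k < m then
      ((q ^ (2 : ℤ) - q ^ (-2 : ℤ)) * q ^ (rho 3 m - rho 3 k)) • (T j (Fin.rev m) * T i m)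
      else 0 else 0)

/-- For a matrix that is block diagonal with respect to the fibres of a monotone map `b`, the RTT
relations have to be checked only inside the blocks and between dual blocks. -/
theorem RTTThree.of_block {B : Type*} [Ring B] [Algebra K B] {q : K} {T : Fin 7 → Fin 7 → B}
    {b : Fin 7 → ℕ} (hb : Monotone b) (hrev : ∀ i k, b i = b k → b (Fin.rev i) = b (Fin.rev k))
    (hT : ∀ i k, b i ≠ b k → T i k = 0)
    (hsame : ∀ i j, b j = b i → ∀ k l, b l = b k → b k = b i →
      j ≠ Fin.rev i → l ≠ Fin.rev k → RTTThree q T i j k l)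
    (hcomm : ∀ i k, b k = b i → ∀ j l, b l = b j → b j ≠ b i →
      j ≠ Fin.rev i → l ≠ Fin.rev k → T i k * T j l = T j l * T i k)
    (hdual : ∀ i j, b j = b (Fin.rev i) → ∀ k l, b l = b (Fin.rev k) →
      (j = Fin.rev i ∨ l = Fin.rev k) → RTTThree q T i j k l) (i j k l : Fin 7) :
    RTTThree q T i j k l := by
  have hlt : ∀ {i j}, b i < b j → i < j := fun h => by
    by_contra h'
    exact absurd (hb (not_lt.1 h')) (not_le.2 h)
  have hmul : ∀ i j k l, ¬ (b i = b j ∧ b k = b l) → T i j * T k l = 0 := by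
    intro i j k l h
    by_cases h1 : b i = b j
    · rw [hT k l fun h2 => h ⟨h1, h2⟩, mul_zero]
    · rw [hT i j h1, zero_mul]
  have hrev' : ∀ i k, b (Fin.rev i) = b k ↔ b i = b (Fin.rev k) := fun i k =>
    ⟨fun h => by simpa using hrev _ _ h, fun h => by simpa using hrev _ _ h⟩
  by_cases hd' : j = Fin.rev i ∨ l = Fin.rev k
  · by_cases hd : b j = b (Fin.rev i) ∧ b l = b (Fin.rev k)
    · exact hdual i j hd.1 k l hd.2 hd'
    · have h1 : ¬ (b i = b k ∧ b j = b l) := by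
        rintro ⟨h, h'⟩
        rcases hd' with e | e
        · exact hd ⟨by rw [e], by rw [← h', e, hrev _ _ h]⟩
        · exact hd ⟨by rw [h', e, hrev _ _ h], by rw [e]⟩
      have h2 : ¬ (b j = b k ∧ b i = b l) := by
        rintro ⟨h, h'⟩
        rcases hd' with e | e
        · exact hd ⟨by rw [e], by rw [← h', ← hrev', ← e, h]⟩
        · exact hd ⟨by rw [h, (hrev' i k).2 (by rw [h', e])], by rw [e]⟩
      have h3 : T i k * T j l = 0 := hmul _ _ _ _ h1
      have h4 : T j l * T i k = 0 := hmul _ _ _ _ fun h => h1 ⟨h.2, h.1⟩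
      have h5 : T j k * T i l = 0 := hmul _ _ _ _ h2
      have h6 : j = Fin.rev i → ∀ m, T m k * T (Fin.rev m) l = 0 := fun e m =>
        hmul _ _ _ _ fun h => hd ⟨by rw [e], by rw [← h.2, hrev _ _ h.1]⟩
      have h7 : l = Fin.rev k → ∀ m, T j (Fin.rev m) * T i m = 0 := fun e m =>
        hmul _ _ _ _ fun h => hd ⟨by rw [h.1, hrev _ _ h.2], by rw [e]⟩
      unfold RTTThree
      rw [h3, h4, h5]
      have h8 : (if j = Fin.rev i then ∑ m : Fin 7, if m < i then
          ((q ^ (2 : ℤ) - q ^ (-2 : ℤ)) * q ^ (rho 3 i - rho 3 m)) • (T m k * T (Fin.rev m) l)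
          else 0 else 0) = 0 := by
        split_ifs with e
        · simp [h6 e]
        · rfl
      have h9 : (if l = Fin.rev k then ∑ m : Fin 7, if k < m then
          ((q ^ (2 : ℤ) - q ^ (-2 : ℤ)) * q ^ (rho 3 m - rho 3 k)) • (T j (Fin.rev m) * T i m)
          else 0 else 0) = 0 := by
        split_ifs with e
        · simp [h7 e]
        · rfl
      rw [h8, h9]
      simp
  · rw [not_or] at hd'
    by_cases h1 : b k = b i ∧ b l = b j
    · by_cases h2 : b j = b i
      · exact hsame i j h2 k l (by rw [h1.2, h2, h1.1]) h1.1 hd'.1 hd'.2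
      · have h3 : T j k * T i l = 0 := hmul _ _ _ _ fun h => h2 (h.1.trans h1.1)
        have h4 : i ≠ j := fun h => h2 (by rw [h])
        have h5 : k ≠ l := fun h => h2 (by rw [← h1.2, ← h1.1, h])
        simp [RTTThree, hd'.1, hd'.2, h3, h4, h5, hcomm i k h1.1 j l h1.2 h2 hd'.1 hd'.2]
    · have h3 : T i k * T j l = 0 := hmul _ _ _ _ fun h => h1 ⟨h.1.symm, h.2.symm⟩
      have h4 : T j l * T i k = 0 := hmul _ _ _ _ fun h => h1 ⟨h.2.symm, h.1.symm⟩
      by_cases h2 : b j = b k ∧ b i = b l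
      -- Only the two flip terms remain, with equal coefficients. Distinct blocks are ordered by the
      -- monotone `b`, so the two order conditions agree.
      · have h5 : j < i ↔ k < l := by
          rcases lt_trichotomy (b j) (b i) with h | h | h
          · exact iff_of_true (hlt h) (hlt (by rw [← h2.1, ← h2.2]; exact h))
          · exact absurd ⟨by rw [← h2.1, h], by rw [← h2.2, h]⟩ h1
          · exact iff_of_false (hlt h).not_gt
              (hlt (by rw [← h2.1, ← h2.2]; exact h)).not_gt
        simp [RTTThree, hd'.1, hd'.2, h3, h4, h5]
      · simp [RTTThree, hd'.1, hd'.2, h3, h4, hmul _ _ _ _ h2]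

theorem smul_mul_smul_osc {p : K} (a b : K) (u v : Osc p) :
    (a • u) * (b • v) = (a * b) • (u * v) := by
  rw [smul_mul_assoc, mul_smul_comm, smul_smul]

theorem Param.Admissible.beta_eq {q : K} {c : Param K} (h : c.Admissible q) :
    c.β = - q ^ 2 * c.μ * c.ν * c.α⁻¹ := by
  rw [← h.mul_eq, mul_assoc, mul_comm c.β, ← mul_assoc, mul_inv_cancel₀ h.α_ne, one_mul]

theorem Param.Admissible.sigma_sq {q : K} {c : Param K} (h : c.Admissible q) :
    c.σ * c.σ = 1 := by
  rcases h.σ_eq with h | h <;> simp [h]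

/-- Applied to (i, j) and then to (k, l), it cuts the check from 7⁴ index quadruples to 11². -/
theorem forall_block_same₁ {P : Fin 7 → Fin 7 → Prop}
    (h : P 0 0 ∧ P 0 1 ∧ P 1 0 ∧ P 1 1 ∧ P 2 2 ∧ P 3 3 ∧ P 4 4 ∧ P 5 5 ∧ P 5 6 ∧ P 6 5 ∧ P 6 6) :
    ∀ i j, (![0, 0, 1, 2, 3, 4, 4] : Fin 7 → ℕ) j =
      (![0, 0, 1, 2, 3, 4, 4] : Fin 7 → ℕ) i → P i j := by
  obtain ⟨h0, h1, h2, h3, h4, h5, h6, h7, h8, h9, h10⟩ := h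
  intro i j
  fin_cases i <;> fin_cases j <;> first
    | (intro _; assumption)
    | (intro h; exact absurd h (by decide))

theorem forall_block_dual₁ {P : Fin 7 → Fin 7 → Prop}
    (h : P 0 5 ∧ P 0 6 ∧ P 1 5 ∧ P 1 6 ∧ P 2 4 ∧ P 3 3 ∧ P 4 2 ∧ P 5 0 ∧ P 5 1 ∧ P 6 0 ∧ P 6 1) :
    ∀ i j, (![0, 0, 1, 2, 3, 4, 4] : Fin 7 → ℕ) j =
      (![0, 0, 1, 2, 3, 4, 4] : Fin 7 → ℕ) (Fin.rev i) → P i j := by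
  obtain ⟨h0, h1, h2, h3, h4, h5, h6, h7, h8, h9, h10⟩ := h
  intro i j
  fin_cases i <;> fin_cases j <;> first
    | (intro _; assumption)
    | (intro h; exact absurd h (by decide))

set_option maxHeartbeats 4000000 in
theorem pi₁Matrix_rttThree {q : K} (hq : q ≠ 0) {c : Param K} (hα : c.α ≠ 0) (hμ : c.μ ≠ 0)
    (hν : c.ν ≠ 0) (hβ : c.β = - q ^ 2 * c.μ * c.ν * c.α⁻¹) (hσ : c.σ * c.σ = 1)
    (hσi : c.σ⁻¹ = c.σ) (hκ : c.κ = c.σ) (i j k l : Fin 7) :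
    RTTThree q (pi₁Matrix q c) i j k l := by
  have z2 : q ^ (-2 : ℤ) = (q ^ 2)⁻¹ := by rw [zpow_neg, zpow_ofNat]
  have y2 : q ^ (2 : ℤ) = q ^ 2 := zpow_ofNat q 2
  -- The fibres of `b` are the diagonal blocks M, κ, σ, κ⁻¹, M' of the matrix.
  refine RTTThree.of_block (b := ![0, 0, 1, 2, 3, 4, 4]) (by decide) (by decide) ?_ ?_ ?_ ?_
    i j k l
  · intro i k
    fin_cases i <;> fin_cases k <;> first
      | (intro _; rfl)
      | (intro h; exact absurd rfl h)
  · refine forall_block_same₁ ?_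
    refine ⟨?_, ?_, ?_, ?_, ?_, ?_, ?_, ?_, ?_, ?_, ?_⟩
    all_goals refine forall_block_same₁ ?_
    all_goals refine ⟨?_, ?_, ?_, ?_, ?_, ?_, ?_, ?_, ?_, ?_, ?_⟩
    all_goals first
      | (intro h; exact absurd h (by decide))
      | (intro _ h; exact absurd rfl h)
      | (intro _ _ _; unfold RTTThree
         simp only [rev_seven, Fin.isValue, Fin.reduceEq, Fin.reduceLT, lt_self_iff_false,
          reduceIte, pi₁Matrix_apply, add_zero, sub_zero, smul_mul_smul_osc, k_mul_ap, k_mul_am,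
          am_mul_ap, ap_mul_am, hβ, z2, y2]
         try (match_scalars <;> field_simp <;> try ring))
  · refine forall_block_same₁ ?_
    refine ⟨?_, ?_, ?_, ?_, ?_, ?_, ?_, ?_, ?_, ?_, ?_⟩
    all_goals refine forall_block_same₁ ?_
    all_goals refine ⟨?_, ?_, ?_, ?_, ?_, ?_, ?_, ?_, ?_, ?_, ?_⟩
    all_goals first
      | (intro h; exact absurd rfl h)
      | (intro _ h; exact absurd rfl h)
      | (intro _ _ h; exact absurd rfl h)
      | (intro _ _ _; simp only [pi₁Matrix_apply, smul_mul_smul_osc, mul_one, one_mul]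
         match_scalars
         field_simp)
  · refine forall_block_dual₁ ?_
    refine ⟨?_, ?_, ?_, ?_, ?_, ?_, ?_, ?_, ?_, ?_, ?_⟩
    all_goals refine forall_block_dual₁ ?_
    all_goals refine ⟨?_, ?_, ?_, ?_, ?_, ?_, ?_, ?_, ?_, ?_, ?_⟩
    all_goals first
      | (intro h; exact absurd h (by decide))
      | (intro _
         unfold RTTThree
         simp only [Fin.sum_univ_seven, rev_seven, Fin.isValue, Fin.reduceEq, Fin.reduceLT,
          lt_self_iff_false, reduceIte, pi₁Matrix_apply, mul_zero, smul_zero, add_zero,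
          sub_zero, zero_add, smul_mul_smul_osc, k_mul_ap, k_mul_am, am_mul_ap, ap_mul_am,
          mul_one, hβ,
          hσ, hσi, hκ, rho_three, Int.reduceSub, Int.reduceNeg, zpow_neg, zpow_ofNat])
    all_goals match_scalars
    all_goals field_simp
    all_goals try ring

theorem forall_block_same₂ {P : Fin 7 → Fin 7 → Prop}
    (h : P 0 0 ∧ P 1 1 ∧ P 1 2 ∧ P 2 1 ∧ P 2 2 ∧ P 3 3 ∧ P 4 4 ∧ P 4 5 ∧ P 5 4 ∧ P 5 5 ∧ P 6 6) :
    ∀ i j, (![0, 1, 1, 2, 3, 3, 4] : Fin 7 → ℕ) j =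
      (![0, 1, 1, 2, 3, 3, 4] : Fin 7 → ℕ) i → P i j := by
  obtain ⟨h0, h1, h2, h3, h4, h5, h6, h7, h8, h9, h10⟩ := h
  intro i j
  fin_cases i <;> fin_cases j <;> first
    | (intro _; assumption)
    | (intro h; exact absurd h (by decide))

theorem forall_block_dual₂ {P : Fin 7 → Fin 7 → Prop}
    (h : P 0 6 ∧ P 1 4 ∧ P 1 5 ∧ P 2 4 ∧ P 2 5 ∧ P 3 3 ∧ P 4 1 ∧ P 4 2 ∧ P 5 1 ∧ P 5 2 ∧ P 6 0) :
    ∀ i j, (![0, 1, 1, 2, 3, 3, 4] : Fin 7 → ℕ) j =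
      (![0, 1, 1, 2, 3, 3, 4] : Fin 7 → ℕ) (Fin.rev i) → P i j := by
  obtain ⟨h0, h1, h2, h3, h4, h5, h6, h7, h8, h9, h10⟩ := h
  intro i j
  fin_cases i <;> fin_cases j <;> first
    | (intro _; assumption)
    | (intro h; exact absurd h (by decide))

set_option maxHeartbeats 4000000 in
theorem pi₂Matrix_rttThree {q : K} (hq : q ≠ 0) {c : Param K} (hα : c.α ≠ 0) (hμ : c.μ ≠ 0)
    (hν : c.ν ≠ 0) (hβ : c.β = - q ^ 2 * c.μ * c.ν * c.α⁻¹) (hσ : c.σ * c.σ = 1)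
    (hσi : c.σ⁻¹ = c.σ) (hκ : c.κ = c.σ) (i j k l : Fin 7) :
    RTTThree q (pi₂Matrix q c) i j k l := by
  have z2 : q ^ (-2 : ℤ) = (q ^ 2)⁻¹ := by rw [zpow_neg, zpow_ofNat]
  have y2 : q ^ (2 : ℤ) = q ^ 2 := zpow_ofNat q 2
  refine RTTThree.of_block (b := ![0, 1, 1, 2, 3, 3, 4]) (by decide) (by decide) ?_ ?_ ?_ ?_
    i j k l
  · intro i k
    fin_cases i <;> fin_cases k <;> first
      | (intro _; rfl)
      | (intro h; exact absurd rfl h)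
  · refine forall_block_same₂ ?_
    refine ⟨?_, ?_, ?_, ?_, ?_, ?_, ?_, ?_, ?_, ?_, ?_⟩
    all_goals refine forall_block_same₂ ?_
    all_goals refine ⟨?_, ?_, ?_, ?_, ?_, ?_, ?_, ?_, ?_, ?_, ?_⟩
    all_goals first
      | (intro h; exact absurd h (by decide))
      | (intro _ h; exact absurd rfl h)
      | (intro _ _ _; unfold RTTThree
         simp only [rev_seven, Fin.isValue, Fin.reduceEq, Fin.reduceLT, lt_self_iff_false,
          reduceIte, pi₂Matrix_apply, add_zero, sub_zero, smul_mul_smul_osc, k_mul_ap, k_mul_am,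
          am_mul_ap, ap_mul_am, hβ, z2, y2]
         try (match_scalars <;> field_simp <;> try ring))
  · refine forall_block_same₂ ?_
    refine ⟨?_, ?_, ?_, ?_, ?_, ?_, ?_, ?_, ?_, ?_, ?_⟩
    all_goals refine forall_block_same₂ ?_
    all_goals refine ⟨?_, ?_, ?_, ?_, ?_, ?_, ?_, ?_, ?_, ?_, ?_⟩
    all_goals first
      | (intro h; exact absurd rfl h)
      | (intro _ h; exact absurd rfl h)
      | (intro _ _ h; exact absurd rfl h)
      | (intro _ _ _; simp only [pi₂Matrix_apply, smul_mul_smul_osc, mul_one, one_mul]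
         match_scalars
         field_simp)
  · refine forall_block_dual₂ ?_
    refine ⟨?_, ?_, ?_, ?_, ?_, ?_, ?_, ?_, ?_, ?_, ?_⟩
    all_goals refine forall_block_dual₂ ?_
    all_goals refine ⟨?_, ?_, ?_, ?_, ?_, ?_, ?_, ?_, ?_, ?_, ?_⟩
    all_goals first
      | (intro h; exact absurd h (by decide))
      | (intro _
         unfold RTTThree
         simp only [Fin.sum_univ_seven, rev_seven, Fin.isValue, Fin.reduceEq, Fin.reduceLT,
          lt_self_iff_false, reduceIte, pi₂Matrix_apply, mul_zero, smul_zero, add_zero,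
          sub_zero, zero_add, smul_mul_smul_osc, k_mul_ap, k_mul_am, am_mul_ap, ap_mul_am,
          mul_one, hβ,
          hσ, hσi, hκ, rho_three, Int.reduceSub, Int.reduceNeg, zpow_neg, zpow_ofNat])
    all_goals match_scalars
    all_goals field_simp
    all_goals try ring

set_option maxHeartbeats 4000000 in
theorem pi₁Matrix_orth_left {q : K} (hq : q ≠ 0) {c : Param K} (hα : c.α ≠ 0) (hμ : c.μ ≠ 0)
    (hν : c.ν ≠ 0) (hβ : c.β = - q ^ 2 * c.μ * c.ν * c.α⁻¹) (hσ : c.σ * c.σ = 1)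
    (hσi : c.σ⁻¹ = c.σ) (hκ : c.κ = c.σ) :
    ∀ i m : Fin 7, ∑ j : Fin 7,
      q ^ (rho 3 m - rho 3 j) • (pi₁Matrix q c i j * pi₁Matrix q c (Fin.rev m) (Fin.rev j)) =
      if i = m then 1 else 0 := by
  refine forall_fin_seven.2 ⟨?_, ?_, ?_, ?_, ?_, ?_, ?_⟩
  all_goals refine forall_fin_seven.2 ⟨?_, ?_, ?_, ?_, ?_, ?_, ?_⟩
  all_goals
    simp only [Fin.sum_univ_seven, rev_seven, Fin.isValue, Fin.reduceEq, reduceIte,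
      pi₁Matrix_apply, mul_zero, zero_mul, smul_zero, add_zero, zero_add, smul_mul_smul_osc,
        k_mul_ap,
      k_mul_am, am_mul_ap, ap_mul_am, mul_one, hβ, hσ, hσi, hκ, rho_three, Int.reduceSub,
      Int.reduceNeg, zpow_neg, zpow_ofNat]
  all_goals match_scalars
  all_goals field_simp
  all_goals try ring

set_option maxHeartbeats 4000000 in
theorem pi₁Matrix_orth_right {q : K} (hq : q ≠ 0) {c : Param K} (hα : c.α ≠ 0) (hμ : c.μ ≠ 0)
    (hν : c.ν ≠ 0) (hβ : c.β = - q ^ 2 * c.μ * c.ν * c.α⁻¹) (hσ : c.σ * c.σ = 1)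
    (hσi : c.σ⁻¹ = c.σ) (hκ : c.κ = c.σ) :
    ∀ i m : Fin 7, ∑ l : Fin 7,
      q ^ (rho 3 l - rho 3 i) • (pi₁Matrix q c (Fin.rev l) (Fin.rev i) * pi₁Matrix q c l m) =
      if i = m then 1 else 0 := by
  refine forall_fin_seven.2 ⟨?_, ?_, ?_, ?_, ?_, ?_, ?_⟩
  all_goals refine forall_fin_seven.2 ⟨?_, ?_, ?_, ?_, ?_, ?_, ?_⟩
  all_goals
    simp only [Fin.sum_univ_seven, rev_seven, Fin.isValue, Fin.reduceEq, reduceIte,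
      pi₁Matrix_apply, mul_zero, zero_mul, smul_zero, add_zero, zero_add, smul_mul_smul_osc,
        k_mul_ap,
      k_mul_am, am_mul_ap, ap_mul_am, mul_one, hβ, hσ, hσi, hκ, rho_three, Int.reduceSub,
      Int.reduceNeg, zpow_neg, zpow_ofNat]
  all_goals match_scalars
  all_goals field_simp
  all_goals try ring

set_option maxHeartbeats 4000000 in
theorem pi₂Matrix_orth_left {q : K} (hq : q ≠ 0) {c : Param K} (hα : c.α ≠ 0) (hμ : c.μ ≠ 0)
    (hν : c.ν ≠ 0) (hβ : c.β = - q ^ 2 * c.μ * c.ν * c.α⁻¹) (hσ : c.σ * c.σ = 1)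
    (hσi : c.σ⁻¹ = c.σ) (hκ : c.κ = c.σ) :
    ∀ i m : Fin 7, ∑ j : Fin 7,
      q ^ (rho 3 m - rho 3 j) • (pi₂Matrix q c i j * pi₂Matrix q c (Fin.rev m) (Fin.rev j)) =
      if i = m then 1 else 0 := by
  refine forall_fin_seven.2 ⟨?_, ?_, ?_, ?_, ?_, ?_, ?_⟩
  all_goals refine forall_fin_seven.2 ⟨?_, ?_, ?_, ?_, ?_, ?_, ?_⟩
  all_goals
    simp only [Fin.sum_univ_seven, rev_seven, Fin.isValue, Fin.reduceEq, reduceIte,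
      pi₂Matrix_apply, mul_zero, zero_mul, smul_zero, add_zero, zero_add, smul_mul_smul_osc,
        k_mul_ap,
      k_mul_am, am_mul_ap, ap_mul_am, mul_one, hβ, hσ, hσi, hκ, rho_three, Int.reduceSub,
      Int.reduceNeg, zpow_neg, zpow_ofNat]
  all_goals match_scalars
  all_goals field_simp
  all_goals try ring

set_option maxHeartbeats 4000000 in
theorem pi₂Matrix_orth_right {q : K} (hq : q ≠ 0) {c : Param K} (hα : c.α ≠ 0) (hμ : c.μ ≠ 0)
    (hν : c.ν ≠ 0) (hβ : c.β = - q ^ 2 * c.μ * c.ν * c.α⁻¹) (hσ : c.σ * c.σ = 1)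
    (hσi : c.σ⁻¹ = c.σ) (hκ : c.κ = c.σ) :
    ∀ i m : Fin 7, ∑ l : Fin 7,
      q ^ (rho 3 l - rho 3 i) • (pi₂Matrix q c (Fin.rev l) (Fin.rev i) * pi₂Matrix q c l m) =
      if i = m then 1 else 0 := by
  refine forall_fin_seven.2 ⟨?_, ?_, ?_, ?_, ?_, ?_, ?_⟩
  all_goals refine forall_fin_seven.2 ⟨?_, ?_, ?_, ?_, ?_, ?_, ?_⟩
  all_goals
    simp only [Fin.sum_univ_seven, rev_seven, Fin.isValue, Fin.reduceEq, reduceIte,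
      pi₂Matrix_apply, mul_zero, zero_mul, smul_zero, add_zero, zero_add, smul_mul_smul_osc,
        k_mul_ap,
      k_mul_am, am_mul_ap, ap_mul_am, mul_one, hβ, hσ, hσi, hκ, rho_three, Int.reduceSub,
      Int.reduceNeg, zpow_neg, zpow_ofNat]
  all_goals match_scalars
  all_goals field_simp
  all_goals try ring

theorem exists_pi₁ {q : K} (hq : q ≠ 0) {c : Param K} (h : c.Admissible q) (hκ : c.κ = c.σ) :
    ∃ π : A 3 q →ₐ[K] Osc (q ^ 2), ∀ i j : Fin 7, π (t 3 q i j) = pi₁Matrix q c i j := by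
  have hi : c.σ⁻¹ = c.σ := inv_eq_of_mul_eq_one_left h.sigma_sq
  exact exists_algHom 3 hq (pi₁Matrix q c)
    (pi₁Matrix_rttThree hq h.α_ne h.μ_ne h.ν_ne h.beta_eq h.sigma_sq hi hκ)
    (pi₁Matrix_orth_left hq h.α_ne h.μ_ne h.ν_ne h.beta_eq h.sigma_sq hi hκ)
    (pi₁Matrix_orth_right hq h.α_ne h.μ_ne h.ν_ne h.beta_eq h.sigma_sq hi hκ)

theorem exists_pi₂ {q : K} (hq : q ≠ 0) {c : Param K} (h : c.Admissible q) (hκ : c.κ = c.σ) :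
    ∃ π : A 3 q →ₐ[K] Osc (q ^ 2), ∀ i j : Fin 7, π (t 3 q i j) = pi₂Matrix q c i j := by
  have hi : c.σ⁻¹ = c.σ := inv_eq_of_mul_eq_one_left h.sigma_sq
  exact exists_algHom 3 hq (pi₂Matrix q c)
    (pi₂Matrix_rttThree hq h.α_ne h.μ_ne h.ν_ne h.beta_eq h.sigma_sq hi hκ)
    (pi₂Matrix_orth_left hq h.α_ne h.μ_ne h.ν_ne h.beta_eq h.sigma_sq hi hκ)
    (pi₂Matrix_orth_right hq h.α_ne h.μ_ne h.ν_ne h.beta_eq h.sigma_sq hi hκ)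

end FundamentalRepresentations

/-! ### Quantum matrix relations for the 3 × 3 blocks. -/

/-- The relations of the quantum matrix algebra `M_p(3)`. -/
structure IsQuantumMatrix {B : Type*} [Semiring B] [Algebra K B] (p : K)
    (X : Fin 3 → Fin 3 → B) : Prop where
  row : ∀ i k l, k < l → X i k * X i l = p • (X i l * X i k)
  col : ∀ k i j, i < j → X i k * X j k = p • (X j k * X i k)
  anti : ∀ i j k l, i < j → l < k → X i k * X j l = X j l * X i k
  diag : ∀ i j k l, i < j → k < l →
    X i k * X j l = X j l * X i k + (p - p⁻¹) • (X j k * X i l)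

theorem IsQuantumMatrix.map {B B' : Type*} [Semiring B] [Algebra K B] [Semiring B']
  [Algebra K B'] {p : K}
    {X : Fin 3 → Fin 3 → B} (h : IsQuantumMatrix p X) (f : B →ₐ[K] B') :
    IsQuantumMatrix p fun i j => f (X i j) where
  row i k l hkl := by simp only [← map_mul, ← map_smul, h.row i k l hkl]
  col k i j hij := by simp only [← map_mul, ← map_smul, h.col k i j hij]
  anti i j k l hij hlk := by simp only [← map_mul, h.anti i j k l hij hlk]
  diag i j k l hij hkl := by
    simp only [← map_mul, ← map_smul, ← map_add, h.diag i j k l hij hkl]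

/-- For two entries in one row, the RTT relation contains the same product on both sides; solving
for it gives p-commutation. -/
theorem eq_smul_of_smul_eq {M : Type*} [AddCommGroup M] [Module K M] {p : K} (hp : p ≠ 0) {x y : M}
    (h : p • x = (1 : K) • y + (p - p⁻¹) • x) : x = p • y := by
  have h1 : y = p⁻¹ • x := by
    rw [one_smul, sub_smul, ← sub_eq_iff_eq_add] at h
    rw [← h]
    abel
  rw [h1, smul_smul, mul_inv_cancel₀ hp, one_smul]

/-- The entries of a solution of the RTT relations with indices in a set containing no pair of
dual indices form a quantum matrix. -/
theorem isQuantumMatrix_of_rtt {B : Type*} [Ring B] [Algebra K B] {n : ℕ} {q : K} (hq : q ≠ 0)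
    {T : Fin (2 * n + 1) → Fin (2 * n + 1) → B}
    (hT : ∀ i j k l, ∑ m, ∑ p, R n q i j m p • (T m k * T p l) =
      ∑ m, ∑ p, R n q m p k l • (T j p * T i m)) {s : Fin 3 → Fin (2 * n + 1)}
    (hs : StrictMono s) (hrev : ∀ i j, s j ≠ Fin.rev (s i)) :
    IsQuantumMatrix (q ^ 2) fun i j => T (s i) (s j) := by
  have key : ∀ i j k l, (if i = j then q ^ 2 else 1 : K) • (T (s i) (s k) * T (s j) (s l))
      + (if j < i then (q ^ 2 - (q ^ 2)⁻¹) • (T (s j) (s k) * T (s i) (s l)) else 0)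
      = (if k = l then q ^ 2 else 1 : K) • (T (s j) (s l) * T (s i) (s k))
      + (if k < l then (q ^ 2 - (q ^ 2)⁻¹) • (T (s j) (s k) * T (s i) (s l)) else 0) := by
    intro i j k l
    have h := hT (s i) (s j) (s k) (s l)
    rw [sum_R_left, sum_R_right] at h
    simpa only [hrev, (hrev _ _).symm, if_false, hs.injective.eq_iff, hs.lt_iff_lt, sub_zero,
      zpow_neg, zpow_ofNat] using h
  refine ⟨fun i k l h => ?_, fun k i j h => ?_, fun i j k l h h' => ?_, fun i j k l h h' => ?_⟩
  · have e := key i i k l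
    simp only [if_true, lt_irrefl, if_false, add_zero, h.ne, h] at e
    exact eq_smul_of_smul_eq (pow_ne_zero 2 hq) e
  · have e := key i j k k
    simpa only [if_true, lt_irrefl, if_false, add_zero, h.ne, h.not_gt, one_smul] using e
  · have e := key i j k l
    simpa only [if_false, add_zero, h.ne, h.not_gt, h'.ne', h'.not_gt, one_smul] using e
  · have e := key i j k l
    simpa only [if_true, if_false, add_zero, h.ne, h.not_gt, h'.ne, h', one_smul] using e

/-! ### Intertwiners of quantum matrices generated from a vacuum. -/

section Intertwiner

variable {V W : Type*} [AddCommMonoid V] [Module K V] [AddCommMonoid W] [Module K W]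

/-- The monomials `X₃₂ⁱ X₃₃ʲ X₂₃ᵏ` applied to a vector. -/
def mono (X : Fin 3 → Fin 3 → Module.End K V) (v : V) (i j k : ℕ) : V :=
  (X 2 1 ^ i) ((X 2 2 ^ j) ((X 1 2 ^ k) v))

theorem mono_succ_left (X : Fin 3 → Fin 3 → Module.End K V) (v : V) (i j k : ℕ) :
    mono X v (i + 1) j k = X 2 1 (mono X v i j k) := by
  simp [mono, pow_succ']

theorem mono_zero_succ (X : Fin 3 → Fin 3 → Module.End K V) (v : V) (j k : ℕ) :
    mono X v 0 (j + 1) k = X 2 2 (mono X v 0 j k) := by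
  simp [mono, pow_succ']

theorem mono_zero_zero_succ (X : Fin 3 → Fin 3 → Module.End K V) (v : V) (k : ℕ) :
    mono X v 0 0 (k + 1) = X 1 2 (mono X v 0 0 k) := by
  simp [mono, pow_succ']

theorem mono_zero (X : Fin 3 → Fin 3 → Module.End K V) (v : V) : mono X v 0 0 0 = v := by
  simp [mono]

/-- The inductive step for moving x through one creation operator u. The term z w is the correction
in the diagonal relation; z must already intertwine everywhere, but w only at v. -/
theorem intertwine_step {Φ : V →ₗ[K] W} {x u z w : Module.End K V} {x' u' z' w' : Module.End K W}
    {c d : K} (h : x * u = c • (u * x) + d • (z * w)) (h' : x' * u' = c • (u' * x') + d • (z' * w'))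
    (hu : Φ ∘ₗ u = u' ∘ₗ Φ) (hz : Φ ∘ₗ z = z' ∘ₗ Φ) {v : V} (hv : Φ (x v) = x' (Φ v))
    (hw : Φ (w v) = w' (Φ v)) : Φ (x (u v)) = x' (Φ (u v)) := by
  have hu1 : ∀ v, Φ (u v) = u' (Φ v) := fun v => LinearMap.congr_fun hu v
  have hz1 : ∀ v, Φ (z v) = z' (Φ v) := fun v => LinearMap.congr_fun hz v
  have h1 : x (u v) = c • u (x v) + d • z (w v) := LinearMap.congr_fun h v
  have h1' : x' (u' (Φ v)) = c • u' (x' (Φ v)) + d • z' (w' (Φ v)) := LinearMap.congr_fun h' (Φ v)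
  rw [h1, hu1 v, h1', map_add, map_smul, map_smul, hu1, hz1, hv, hw]

theorem intertwine_step_comm {Φ : V →ₗ[K] W} {x u : Module.End K V} {x' u' : Module.End K W}
    {c : K} (h : x * u = c • (u * x)) (h' : x' * u' = c • (u' * x'))
    (hu : Φ ∘ₗ u = u' ∘ₗ Φ) {v : V} (hv : Φ (x v) = x' (Φ v)) :
    Φ (x (u v)) = x' (Φ (u v)) :=
  intertwine_step (c := c) (d := 0) (z := 0) (w := 0) (z' := 0) (w' := 0) (by simpa using h)
    (by simpa using h') hu (by simp) hv (by simp)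

/-- A linear map defined on the vectors `X₃₂ⁱ X₃₃ʲ X₂₃ᵏ v` intertwines two quantum matrices if it
does so on the vacuum. -/
theorem intertwine_of_mono {p : K} (hp : p ≠ 0) {X : Fin 3 → Fin 3 → Module.End K V}
    {Y : Fin 3 → Fin 3 → Module.End K W} (hX : IsQuantumMatrix p X) (hY : IsQuantumMatrix p Y)
    {v : V} {w : W} {Φ : V →ₗ[K] W} (hΦ : ∀ i j k, Φ (mono X v i j k) = mono Y w i j k)
    (hspan : Submodule.span K (Set.range fun s : ℕ × ℕ × ℕ => mono X v s.1 s.2.1 s.2.2) = ⊤)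
    {e : Fin 3 → Fin 3 → K}
    (hv : ∀ a b, (a, b) ∉ ({(2, 1), (2, 2), (1, 2)} : Set (Fin 3 × Fin 3)) →
      X a b v = e a b • v ∧ Y a b w = e a b • w) (a b : Fin 3) :
    Φ ∘ₗ X a b = Y a b ∘ₗ Φ := by
  have h0 : Φ v = w := by
    have := hΦ 0 0 0
    rwa [mono_zero, mono_zero] at this
  have ext : ∀ (x : Module.End K V) (y : Module.End K W),
      (∀ i j k, Φ (x (mono X v i j k)) = y (Φ (mono X v i j k))) → Φ ∘ₗ x = y ∘ₗ Φ := by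
    intro x y h
    refine LinearMap.ext_on hspan ?_
    rintro _ ⟨⟨i, j, k⟩, rfl⟩
    exact h i j k
  -- The three creation operators come in the order of the monomial: the leftmost just raises an
  -- exponent, and each of the others is moved past those to its left.
  have g21 : Φ ∘ₗ X 2 1 = Y 2 1 ∘ₗ Φ := by
    refine ext _ _ fun i j k => ?_
    rw [← mono_succ_left, hΦ, hΦ, mono_succ_left]
  have c22X : X 2 2 * X 2 1 = p⁻¹ • (X 2 1 * X 2 2) := by
    rw [hX.row 2 1 2 (by decide), smul_smul, inv_mul_cancel₀ hp, one_smul]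
  have c22Y : Y 2 2 * Y 2 1 = p⁻¹ • (Y 2 1 * Y 2 2) := by
    rw [hY.row 2 1 2 (by decide), smul_smul, inv_mul_cancel₀ hp, one_smul]
  have g22 : Φ ∘ₗ X 2 2 = Y 2 2 ∘ₗ Φ := by
    refine ext _ _ fun i j k => ?_
    induction i with
    | zero => rw [← mono_zero_succ, hΦ, hΦ, mono_zero_succ]
    | succ i ih =>
      rw [mono_succ_left]
      exact intertwine_step_comm c22X c22Y g21 ih
  have g12 : Φ ∘ₗ X 1 2 = Y 1 2 ∘ₗ Φ := by
    refine ext _ _ fun i j k => ?_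
    induction i with
    | zero =>
      induction j with
      | zero => rw [← mono_zero_zero_succ, hΦ, hΦ, mono_zero_zero_succ]
      | succ j ih =>
        rw [mono_zero_succ]
        exact intertwine_step_comm (hX.col 2 1 2 (by decide)) (hY.col 2 1 2 (by decide)) g22 ih
    | succ i ih =>
      rw [mono_succ_left]
      exact intertwine_step_comm (c := 1) (by simpa using hX.anti 1 2 2 1 (by decide) (by decide))
        (by simpa using hY.anti 1 2 2 1 (by decide) (by decide)) g21 ih
  have prop : ∀ {x : Module.End K V} {y : Module.End K W}, Φ (x v) = y (Φ v) →
      (∀ u, Φ (x u) = y (Φ u) → Φ (x (X 2 1 u)) = y (Φ (X 2 1 u))) →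
      (∀ u, Φ (x u) = y (Φ u) → Φ (x (X 2 2 u)) = y (Φ (X 2 2 u))) →
      (∀ u, Φ (x u) = y (Φ u) → Φ (x (X 1 2 u)) = y (Φ (X 1 2 u))) → Φ ∘ₗ x = y ∘ₗ Φ := by
    intro x y hv h1 h2 h3
    refine ext _ _ fun i j k => ?_
    induction i with
    | zero =>
      induction j with
      | zero =>
        induction k with
        | zero => rwa [mono_zero]
        | succ k ih => rw [mono_zero_zero_succ]; exact h3 _ ih
      | succ j ih => rw [mono_zero_succ]; exact h2 _ ih
    | succ i ih => rw [mono_succ_left]; exact h1 _ ih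
  have vac : ∀ a b, (a, b) ∉ ({(2, 1), (2, 2), (1, 2)} : Set (Fin 3 × Fin 3)) →
      Φ (X a b v) = Y a b (Φ v) := by
    intro a b hab
    rw [(hv a b hab).1, map_smul, h0, (hv a b hab).2]
  have ap : ∀ {x : Module.End K V} {y : Module.End K W}, Φ ∘ₗ x = y ∘ₗ Φ →
      ∀ u, Φ (x u) = y (Φ u) := fun h u => LinearMap.congr_fun h u
  have d : ∀ i j k l : Fin 3, i < j → k < l → Φ ∘ₗ X j l = Y j l ∘ₗ Φ → Φ ∘ₗ X j k = Y j k ∘ₗ Φ →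
      Φ ∘ₗ X i l = Y i l ∘ₗ Φ → ∀ u, Φ (X i k u) = Y i k (Φ u) →
      Φ (X i k (X j l u)) = Y i k (Φ (X j l u)) := by
    intro i j k l hij hkl hu hz hw u h
    exact intertwine_step (c := 1) (by simpa using hX.diag i j k l hij hkl)
      (by simpa using hY.diag i j k l hij hkl) hu hz h (ap hw u)
  have r : ∀ i k l : Fin 3, k < l → Φ ∘ₗ X i l = Y i l ∘ₗ Φ → ∀ u, Φ (X i k u) = Y i k (Φ u) →
      Φ (X i k (X i l u)) = Y i k (Φ (X i l u)) := fun i k l hkl hu u h =>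
    intertwine_step_comm (hX.row i k l hkl) (hY.row i k l hkl) hu h
  have c : ∀ k i j : Fin 3, i < j → Φ ∘ₗ X j k = Y j k ∘ₗ Φ → ∀ u, Φ (X i k u) = Y i k (Φ u) →
      Φ (X i k (X j k u)) = Y i k (Φ (X j k u)) := fun k i j hij hu u h =>
    intertwine_step_comm (hX.col k i j hij) (hY.col k i j hij) hu h
  -- From here the order is chosen so that every correction X_jk X_il involves entries already
  -- settled. The two antidiagonal corners need no correction; then come the centre, its neighbours
  -- (0,1) and (1,0), and finally (0,0).
  have g02 : Φ ∘ₗ X 0 2 = Y 0 2 ∘ₗ Φ := by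
    refine prop (vac 0 2 (by simp)) (fun u h => ?_) (c 2 0 2 (by decide) g22)
      (c 2 0 1 (by decide) g12)
    exact intertwine_step_comm (c := 1) (by simpa using hX.anti 0 2 2 1 (by decide) (by decide))
      (by simpa using hY.anti 0 2 2 1 (by decide) (by decide)) g21 h
  have g20 : Φ ∘ₗ X 2 0 = Y 2 0 ∘ₗ Φ := by
    refine prop (vac 2 0 (by simp)) (r 2 0 1 (by decide) g21) (r 2 0 2 (by decide) g22)
      (fun u h => ?_)
    exact intertwine_step_comm (c := 1)
      (by simpa using (hX.anti 1 2 2 0 (by decide) (by decide)).symm)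
      (by simpa using (hY.anti 1 2 2 0 (by decide) (by decide)).symm) g12 h
  have g11 : Φ ∘ₗ X 1 1 = Y 1 1 ∘ₗ Φ :=
    prop (vac 1 1 (by simp)) (c 1 1 2 (by decide) g21)
      (d 1 2 1 2 (by decide) (by decide) g22 g21 g12) (r 1 1 2 (by decide) g12)
  have g01 : Φ ∘ₗ X 0 1 = Y 0 1 ∘ₗ Φ :=
    prop (vac 0 1 (by simp)) (c 1 0 2 (by decide) g21)
      (d 0 2 1 2 (by decide) (by decide) g22 g21 g02)
      (d 0 1 1 2 (by decide) (by decide) g12 g11 g02)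
  have g10 : Φ ∘ₗ X 1 0 = Y 1 0 ∘ₗ Φ :=
    prop (vac 1 0 (by simp)) (d 1 2 0 1 (by decide) (by decide) g21 g20 g11)
      (d 1 2 0 2 (by decide) (by decide) g22 g20 g12) (r 1 0 2 (by decide) g12)
  have g00 : Φ ∘ₗ X 0 0 = Y 0 0 ∘ₗ Φ :=
    prop (vac 0 0 (by simp)) (d 0 2 0 1 (by decide) (by decide) g21 g20 g01)
      (d 0 2 0 2 (by decide) (by decide) g22 g20 g02)
      (d 0 1 0 2 (by decide) (by decide) g12 g10 g02)
  fin_cases a <;> fin_cases b <;> assumption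

theorem map_mono {X : Fin 3 → Fin 3 → Module.End K V} {Y : Fin 3 → Fin 3 → Module.End K W}
    {Φ : V →ₗ[K] W} (h : ∀ a b, Φ ∘ₗ X a b = Y a b ∘ₗ Φ) (v : V) (i j k : ℕ) :
    Φ (mono X v i j k) = mono Y (Φ v) i j k := by
  have ap : ∀ a b u, Φ (X a b u) = Y a b (Φ u) := fun a b u => LinearMap.congr_fun (h a b) u
  induction i with
  | zero =>
    induction j with
    | zero =>
      induction k with
      | zero => rw [mono_zero, mono_zero]
      | succ k ih => rw [mono_zero_zero_succ, mono_zero_zero_succ, ap, ih]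
    | succ j ih => rw [mono_zero_succ, mono_zero_succ, ap, ih]
  | succ i ih => rw [mono_succ_left, mono_succ_left, ap, ih]

/-- Two intertwiners that agree on a cyclic vector are equal. -/
theorem intertwiner_ext {X : Fin 3 → Fin 3 → Module.End K V} {Y : Fin 3 → Fin 3 → Module.End K W}
    {v : V}
    (hspan : Submodule.span K (Set.range fun s : ℕ × ℕ × ℕ => mono X v s.1 s.2.1 s.2.2) = ⊤)
    {Φ Ψ : V →ₗ[K] W} (hΦ : ∀ a b, Φ ∘ₗ X a b = Y a b ∘ₗ Φ)
    (hΨ : ∀ a b, Ψ ∘ₗ X a b = Y a b ∘ₗ Ψ) (h : Φ v = Ψ v) : Φ = Ψ := by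
  refine LinearMap.ext_on hspan ?_
  rintro _ ⟨⟨i, j, k⟩, rfl⟩
  change Φ (mono X v i j k) = Ψ (mono X v i j k)
  rw [map_mono hΦ, map_mono hΨ, h]

end Intertwiner

/-! ### From one block to the whole algebra. -/

section Extension

variable {V W : Type*} [AddCommMonoid V] [Module K V] [AddCommMonoid W] [Module K W]

/-- For block diagonal representations, a map intertwining the generators in a block intertwines
those in the dual block, since the two blocks are mutually inverse up to transposition. -/
theorem intertwine_dual {n : ℕ} {q : K} (hq : q ≠ 0) {ρ : A n q →ₐ[K] Module.End K V}
    {τ : A n q →ₐ[K] Module.End K W} {Φ : V →ₗ[K] W} {b : Fin (2 * n + 1) → ℕ}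
    (hrev : ∀ i k, b i = b k → b (Fin.rev i) = b (Fin.rev k))
    (hρ : ∀ i j, b i ≠ b j → ρ (t n q i j) = 0) (hτ : ∀ i j, b i ≠ b j → τ (t n q i j) = 0)
    {β : ℕ} (h : ∀ i j, b i = β → b j = β → Φ ∘ₗ ρ (t n q i j) = τ (t n q i j) ∘ₗ Φ)
    (i j : Fin (2 * n + 1)) (hi : b (Fin.rev i) = β) (hj : b (Fin.rev j) = β) :
    Φ ∘ₗ ρ (t n q i j) = τ (t n q i j) ∘ₗ Φ := by
  have hl : ∀ i m, ∑ j, q ^ (rho n m - rho n j) •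
      (ρ (t n q i j) * ρ (t n q (Fin.rev m) (Fin.rev j))) = if i = m then 1 else 0 := by
    intro i m
    have e := congrArg ρ (orth_left n q i m)
    rw [apply_ite ρ, map_one, map_zero] at e
    simp only [map_sum, map_smul, map_mul] at e
    rw [← e, sum_C_left n hq fun i j => ρ (t n q i j)]
  have hr : ∀ i m, ∑ l, q ^ (rho n l - rho n i) •
      (τ (t n q (Fin.rev l) (Fin.rev i)) * τ (t n q l m)) = if i = m then 1 else 0 := by
    intro i m
    have e := congrArg τ (orth_right n q i m)
    rw [apply_ite τ, map_one, map_zero] at e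
    simp only [map_sum, map_smul, map_mul] at e
    rw [← e, sum_C_right n hq fun i j => τ (t n q i j)]
  suffices key : ∀ j m, b j = β → b m = β → ∀ v,
      Φ (q ^ (rho n m - rho n j) • ρ (t n q (Fin.rev m) (Fin.rev j)) v) =
        q ^ (rho n m - rho n j) • τ (t n q (Fin.rev m) (Fin.rev j)) (Φ v) by
    ext v
    have := key (Fin.rev j) (Fin.rev i) hj hi v
    rw [map_smul, Fin.rev_rev, Fin.rev_rev] at this
    have h' := congrArg (fun w => (q ^ (rho n (Fin.rev i) - rho n (Fin.rev j)))⁻¹ • w) this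
    simp only [smul_smul, inv_mul_cancel₀ (zpow_ne_zero _ hq), one_smul] at h'
    exact h'
  intro j m hj hm v
  -- The vectors `u c` form a column of the right inverse of the matrix ρ(t), applied to v; the
  -- operators `N a` form a row of the left inverse of τ(t).
  set u : Fin (2 * n + 1) → V := fun c =>
    q ^ (rho n m - rho n c) • ρ (t n q (Fin.rev m) (Fin.rev c)) v with hu
  set N : Fin (2 * n + 1) → Module.End K W := fun a =>
    q ^ (rho n a - rho n j) • τ (t n q (Fin.rev a) (Fin.rev j)) with hN
  have e1 : ∀ a, ∑ c, ρ (t n q a c) (u c) = if a = m then v else 0 := by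
    intro a
    have e := LinearMap.congr_fun (hl a m) v
    rw [LinearMap.sum_apply] at e
    have e' : (if a = m then (1 : Module.End K V) else 0) v = if a = m then v else 0 := by
      split_ifs <;> rfl
    rw [← e', ← e]
    refine Finset.sum_congr rfl fun c _ => ?_
    simp [hu]
  have e2 : ∀ c (w : W), ∑ a, N a (τ (t n q a c) w) = if j = c then w else 0 := by
    intro c w
    have e := LinearMap.congr_fun (hr j c) w
    rw [LinearMap.sum_apply] at e
    have e' : (if j = c then (1 : Module.End K W) else 0) w = if j = c then w else 0 := by
      split_ifs <;> rfl
    rw [← e', ← e]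
    refine Finset.sum_congr rfl fun c _ => ?_
    simp [hN]
  -- Intertwining is known only in the block β, which suffices: `N a` vanishes for a outside the
  -- block, and t_ac does for c outside.
  have e3 : ∀ a c, N a (τ (t n q a c) (Φ (u c))) = N a (Φ (ρ (t n q a c) (u c))) := by
    intro a c
    by_cases ha : b a = β
    · by_cases hc : b c = β
      · exact congrArg (N a) (LinearMap.congr_fun (h a c ha hc) (u c)).symm
      · have hac : b a ≠ b c := fun h' => hc (by rw [← h', ha])
        rw [hρ a c hac, hτ a c hac]
        simp
    · have : N a = 0 := by
        rw [hN]
        simp only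
        rw [hτ _ _ fun h' => ha ?_, smul_zero]
        have := hrev _ _ h'
        rw [Fin.rev_rev, Fin.rev_rev] at this
        rw [this, hj]
      rw [this]
      simp
  -- The usual argument that intertwining a matrix gives intertwining its inverse: insert N τ(t) =
  -- 1, move Φ across, then contract ρ(t) u.
  calc Φ (u j) = ∑ c, ∑ a, N a (τ (t n q a c) (Φ (u c))) := by simp [e2]
    _ = ∑ a, N a (Φ (∑ c, ρ (t n q a c) (u c))) := by
      rw [Finset.sum_comm]
      simp only [e3, map_sum]
    _ = N m (Φ v) := by simp [e1, apply_ite]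
    _ = _ := by simp [hN]

theorem intertwine_all {n : ℕ} {q : K} {ρ : A n q →ₐ[K] Module.End K V}
    {τ : A n q →ₐ[K] Module.End K W} {Φ : V →ₗ[K] W}
    (h : ∀ i j, Φ ∘ₗ ρ (t n q i j) = τ (t n q i j) ∘ₗ Φ) (f : A n q) :
    Φ ∘ₗ ρ f = τ f ∘ₗ Φ := by
  obtain ⟨g, rfl⟩ := RingQuot.mkAlgHom_surjective K (Rel n q) f
  induction g using FreeAlgebra.induction with
  | grade0 r =>
    rw [AlgHom.commutes, AlgHom.commutes, AlgHom.commutes]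
    ext v
    simp [Module.algebraMap_end_apply]
  | grade1 x => exact h x.1 x.2
  | mul a b ha hb =>
    rw [map_mul, map_mul, map_mul, Module.End.mul_eq_comp, Module.End.mul_eq_comp,
      ← LinearMap.comp_assoc, ha, LinearMap.comp_assoc, hb, LinearMap.comp_assoc]
  | add a b ha hb =>
    rw [map_add, map_add, map_add, LinearMap.comp_add, LinearMap.add_comp, ha, hb]

end Extension

/-! ### Entries of tensor product representations. -/

section TensorRep

variable {V W : Type*} [AddCommGroup V] [Module K V] [AddCommGroup W] [Module K W]

theorem tensorRep_t (n : ℕ) {q : K} (hq : q ≠ 0) (ρ : A n q →ₐ[K] Module.End K V)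
    (τ : A n q →ₐ[K] Module.End K W) (i j : Fin (2 * n + 1)) :
    tensorRep n hq ρ τ (t n q i j) =
      ∑ k, TensorProduct.map (ρ (t n q i k)) (τ (t n q k j)) := by
  simp [tensorRep, comul_t, Module.endTensorEndAlgHom_apply]
  rfl

theorem tensorRep_t_eq_zero {n : ℕ} {q : K} (hq : q ≠ 0) {ρ : A n q →ₐ[K] Module.End K V}
    {τ : A n q →ₐ[K] Module.End K W} {b : Fin (2 * n + 1) → ℕ}
    (hρ : ∀ i j, b i ≠ b j → ρ (t n q i j) = 0) (hτ : ∀ i j, b i ≠ b j → τ (t n q i j) = 0)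
    (i j : Fin (2 * n + 1)) (h : b i ≠ b j) : tensorRep n hq ρ τ (t n q i j) = 0 := by
  rw [tensorRep_t]
  refine Finset.sum_eq_zero fun k _ => ?_
  by_cases hk : b i = b k
  · rw [hτ k j (by rwa [← hk]), TensorProduct.map_zero_right]
  · rw [hρ i k hk, TensorProduct.map_zero_left]

theorem tensorRep_t_block {n : ℕ} {q : K} (hq : q ≠ 0) (ρ : A n q →ₐ[K] Module.End K V)
    (τ : A n q →ₐ[K] Module.End K W) {I : Type*} [Fintype I] {s : I → Fin (2 * n + 1)}
    (hs : Function.Injective s) (h : ∀ i, ∀ k ∉ Set.range s, ρ (t n q (s i) k) = 0)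
    (i : I) (j : Fin (2 * n + 1)) :
    tensorRep n hq ρ τ (t n q (s i) j) =
      ∑ k, TensorProduct.map (ρ (t n q (s i) (s k))) (τ (t n q (s k) j)) := by
  rw [tensorRep_t]
  refine (Fintype.sum_of_injective s hs _ _ (fun k hk => ?_) fun k => rfl).symm
  rw [h i k hk, TensorProduct.map_zero_left]

end TensorRep

/-! ### The two triple products of 3 × 3 blocks on the three-fold Fock space. -/

/-- The `3 × 3` block `diag(M, κ)` acting on the Fock space. -/
def blockA (p : K) (c : Param K) : Fin 3 → Fin 3 → Module.End K (Fock K) :=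
  ![![c.μ • fockOp p OscGen.am, c.α • fockOp p OscGen.k, 0],
    ![c.β • fockOp p OscGen.k, c.ν • fockOp p OscGen.ap, 0],
    ![0, 0, c.κ • 1]]

/-- The `3 × 3` block `diag(κ, M)` acting on the Fock space. -/
def blockB (p : K) (c : Param K) : Fin 3 → Fin 3 → Module.End K (Fock K) :=
  ![![c.κ • 1, 0, 0],
    ![0, c.μ • fockOp p OscGen.am, c.α • fockOp p OscGen.k],
    ![0, c.β • fockOp p OscGen.k, c.ν • fockOp p OscGen.ap]]

/-- The three-fold tensor product `∑_{k,l} a_{ik} ⊗ b_{kl} ⊗ a_{lj}` of matrices of operators. -/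
def tripleBlock (a b : Fin 3 → Fin 3 → Module.End K (Fock K)) (i j : Fin 3) :
    Module.End K (Fock3 K) :=
  ∑ l, TensorProduct.map (∑ k, TensorProduct.map (a i k) (b k l)) (a l j)

section Action

variable (p : K) (c₁ c₂ : Param K) (a b c : ℕ)

theorem tripleBlock_AB_two_one : tripleBlock (blockA p c₁) (blockB p c₂) 2 1 (ket3 K a b c) =
    (c₁.κ * c₂.β * c₁.ν * p ^ b) • ket3 K a b (c + 1) := by
  simp [tripleBlock, Fin.sum_univ_three, blockA, blockB, ket3, fockOp_ap, fockOp_k,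
    TensorProduct.tmul_smul, ← TensorProduct.smul_tmul', smul_smul]
  congr 1; ring

theorem tripleBlock_AB_two_two : tripleBlock (blockA p c₁) (blockB p c₂) 2 2 (ket3 K a b c) =
    (c₁.κ * c₂.ν * c₁.κ) • ket3 K a (b + 1) c := by
  simp [tripleBlock, Fin.sum_univ_three, blockA, blockB, ket3, fockOp_ap,
    TensorProduct.tmul_smul, ← TensorProduct.smul_tmul', smul_smul]
  congr 1; ring

theorem tripleBlock_AB_one_two : tripleBlock (blockA p c₁) (blockB p c₂) 1 2 (ket3 K a b c) =
    (c₁.κ * c₁.ν * c₂.α * p ^ b) • ket3 K (a + 1) b c := by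
  simp [tripleBlock, Fin.sum_univ_three, blockA, blockB, ket3, fockOp_ap, fockOp_k,
    TensorProduct.tmul_smul, ← TensorProduct.smul_tmul', smul_smul]
  congr 1; ring

theorem tripleBlock_BA_two_one : tripleBlock (blockB p c₂) (blockA p c₁) 2 1 (ket3 K a b c) =
    (c₂.β * c₁.ν * c₂.μ * p ^ a * (1 - p ^ (2 * c))) • ket3 K a (b + 1) (c - 1) +
      (c₂.ν * c₁.κ * c₂.β * p ^ c) • ket3 K (a + 1) b c := by
  simp [tripleBlock, Fin.sum_univ_three, blockA, blockB, ket3, fockOp_ap, fockOp_am, fockOp_k,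
    TensorProduct.tmul_smul, ← TensorProduct.smul_tmul', smul_smul]
  congr 1 <;> (congr 1; ring)

theorem tripleBlock_BA_two_two : tripleBlock (blockB p c₂) (blockA p c₁) 2 2 (ket3 K a b c) =
    (c₂.β * c₁.ν * c₂.α * p ^ (a + c)) • ket3 K a (b + 1) c +
      (c₂.ν * c₁.κ * c₂.ν) • ket3 K (a + 1) b (c + 1) := by
  simp [tripleBlock, Fin.sum_univ_three, blockA, blockB, ket3, fockOp_ap, fockOp_k,
    TensorProduct.tmul_smul, ← TensorProduct.smul_tmul', smul_smul]
  congr 1 <;> (congr 1; ring)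

/-- This entry acts first in the monomials, so the first factor is still |0⟩, where the other term,
containing a⁻, vanishes. -/
theorem tripleBlock_BA_one_two : tripleBlock (blockB p c₂) (blockA p c₁) 1 2 (ket3 K 0 0 c) =
    (c₂.α * c₁.κ * c₂.ν) • ket3 K 0 0 (c + 1) := by
  simp [tripleBlock, Fin.sum_univ_three, blockA, blockB, ket3, fockOp_ap, fockOp_am, fockOp_k,
    TensorProduct.tmul_smul, ← TensorProduct.smul_tmul', smul_smul]
  congr 1; ring

variable {p c₁ c₂}

/-- The zeros of diag(M, κ) leave a single path in each of the three sums, so each entry raises one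
factor. The power p^j is the value of k in the middle factor when X₃₂ acts; X₂₃ acts while that
factor is still |0⟩ and produces no power. -/
theorem mono_AB (i j k : ℕ) :
    mono (tripleBlock (blockA p c₁) (blockB p c₂)) (ket3 K 0 0 0) i j k =
      ((c₁.κ * c₂.β * c₁.ν * p ^ j) ^ i * (c₁.κ * c₂.ν * c₁.κ) ^ j *
        (c₁.κ * c₁.ν * c₂.α) ^ k) • ket3 K k j i := by
  induction i with
  | zero =>
    induction j with
    | zero =>
      induction k with
      | zero => simp [mono_zero]
      | succ k ih =>
        rw [mono_zero_zero_succ, ih, map_smul, tripleBlock_AB_one_two, smul_smul]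
        congr 1; ring
    | succ j ih =>
      rw [mono_zero_succ, ih, map_smul, tripleBlock_AB_two_two, smul_smul]
      congr 1; ring
  | succ i ih =>
    rw [mono_succ_left, ih, map_smul, tripleBlock_AB_two_one, smul_smul]
    congr 1; ring

/-- The eigenvalues on the vacuum. -/
def vacuumValue (c₁ c₂ : Param K) : Fin 3 → Fin 3 → K :=
  ![![0, 0, c₁.κ * c₁.α * c₂.α], ![0, c₁.κ * c₁.α * c₁.β, 0], ![c₁.κ * c₁.β * c₂.β, 0, 0]]

/-- On the vacuum only paths made of k and scalars survive. Equality of the antidiagonal corners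
needs κ₁ = κ₂; the centre, with values κ₂α₁β₁ and κ₁α₂β₂, also needs α₁β₁ = α₂β₂. -/
theorem tripleBlock_vacuum (hκ : c₁.κ = c₂.κ) (h : c₁.α * c₁.β = c₂.α * c₂.β) (a b : Fin 3)
    (hab : (a, b) ∉ ({(2, 1), (2, 2), (1, 2)} : Set (Fin 3 × Fin 3))) :
    tripleBlock (blockA p c₁) (blockB p c₂) a b (ket3 K 0 0 0) =
      vacuumValue c₁ c₂ a b • ket3 K 0 0 0 ∧
    tripleBlock (blockB p c₂) (blockA p c₁) a b (ket3 K 0 0 0) =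
      vacuumValue c₁ c₂ a b • ket3 K 0 0 0 := by
  fin_cases a <;> fin_cases b <;> first
    | (exfalso; simp at hab; done)
    | (clear hab
       simp [vacuumValue, tripleBlock, Fin.sum_univ_three, blockA, blockB, ket3, fockOp_ap,
        fockOp_am, fockOp_k, TensorProduct.tmul_smul, ← TensorProduct.smul_tmul', smul_smul]
       done)
    | (clear hab
       simp [vacuumValue, tripleBlock, Fin.sum_univ_three, blockA, blockB, ket3, fockOp_ap,
        fockOp_am, fockOp_k, TensorProduct.tmul_smul, ← TensorProduct.smul_tmul', smul_smul]
       refine ⟨?_, ?_⟩ <;> congr 1 <;> first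
         | ring1
         | (rw [← hκ]; ring1)
         | linear_combination (- c₁.κ) * h)

end Action

theorem span_mono_AB {p : K} {c₁ c₂ : Param K} (hp : p ≠ 0) (hκ : c₁.κ ≠ 0) (hν : c₁.ν ≠ 0)
    (hα : c₂.α ≠ 0) (hβ : c₂.β ≠ 0) (hν' : c₂.ν ≠ 0) :
    Submodule.span K (Set.range fun s : ℕ × ℕ × ℕ =>
      mono (tripleBlock (blockA p c₁) (blockB p c₂)) (ket3 K 0 0 0) s.1 s.2.1 s.2.2) = ⊤ := by
  rw [eq_top_iff, ← (basis3 K).span_eq, Submodule.span_le]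
  rintro _ ⟨⟨⟨k, j⟩, i⟩, rfl⟩
  rw [basis3_apply]
  have hd : (c₁.κ * c₂.β * c₁.ν * p ^ j) ^ i * (c₁.κ * c₂.ν * c₁.κ) ^ j *
        (c₁.κ * c₁.ν * c₂.α) ^ k ≠ 0 := by positivity
  have h := mono_AB (p := p) (c₁ := c₁) (c₂ := c₂) i j k
  have h' : ket3 K k j i = ((c₁.κ * c₂.β * c₁.ν * p ^ j) ^ i * (c₁.κ * c₂.ν * c₁.κ) ^ j *
        (c₁.κ * c₁.ν * c₂.α) ^ k)⁻¹ •
        mono (tripleBlock (blockA p c₁) (blockB p c₂)) (ket3 K 0 0 0) i j k := by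
    rw [h, smul_smul, inv_mul_cancel₀ hd, one_smul]
  rw [h']
  exact Submodule.smul_mem _ _ (Submodule.subset_span ⟨(i, j, k), rfl⟩)

/-- The normalized intertwiner of the `3 × 3` blocks. -/
def blockIntertwiner (p : K) (c₁ c₂ : Param K) : Module.End K (Fock3 K) :=
  (basis3 K).constr K fun s =>
    ((c₁.κ * c₂.β * c₁.ν * p ^ s.1.2) ^ s.2 * (c₁.κ * c₂.ν * c₁.κ) ^ s.1.2 *
        (c₁.κ * c₁.ν * c₂.α) ^ s.1.1)⁻¹ •
      mono (tripleBlock (blockB p c₂) (blockA p c₁)) (ket3 K 0 0 0) s.2 s.1.2 s.1.1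

theorem blockIntertwiner_ket3 (p : K) (c₁ c₂ : Param K) (i j k : ℕ) :
    blockIntertwiner p c₁ c₂ (ket3 K k j i) =
      ((c₁.κ * c₂.β * c₁.ν * p ^ j) ^ i * (c₁.κ * c₂.ν * c₁.κ) ^ j *
        (c₁.κ * c₁.ν * c₂.α) ^ k)⁻¹ •
      mono (tripleBlock (blockB p c₂) (blockA p c₁)) (ket3 K 0 0 0) i j k := by
  rw [← basis3_apply, blockIntertwiner, Module.Basis.constr_basis]

theorem blockIntertwiner_vacuum (p : K) (c₁ c₂ : Param K) :
    blockIntertwiner p c₁ c₂ (ket3 K 0 0 0) = ket3 K 0 0 0 := by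
  simp [blockIntertwiner_ket3, mono_zero]

theorem blockIntertwiner_intertwines {p : K} {c₁ c₂ : Param K} (hp : p ≠ 0) (hκ : c₁.κ ≠ 0)
    (hν : c₁.ν ≠ 0) (hα : c₂.α ≠ 0) (hβ : c₂.β ≠ 0) (hν' : c₂.ν ≠ 0) (hκκ : c₁.κ = c₂.κ)
    (h : c₁.α * c₁.β = c₂.α * c₂.β)
    (hX : IsQuantumMatrix p (tripleBlock (blockA p c₁) (blockB p c₂)))
    (hY : IsQuantumMatrix p (tripleBlock (blockB p c₂) (blockA p c₁))) (a b : Fin 3) :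
    blockIntertwiner p c₁ c₂ ∘ₗ tripleBlock (blockA p c₁) (blockB p c₂) a b =
      tripleBlock (blockB p c₂) (blockA p c₁) a b ∘ₗ blockIntertwiner p c₁ c₂ := by
  refine intertwine_of_mono hp hX hY (fun i j k => ?_) (span_mono_AB hp hκ hν hα hβ hν')
    (tripleBlock_vacuum hκκ h) a b
  have hd : (c₁.κ * c₂.β * c₁.ν * p ^ j) ^ i * (c₁.κ * c₂.ν * c₁.κ) ^ j *
        (c₁.κ * c₁.ν * c₂.α) ^ k ≠ 0 := by positivity
  rw [mono_AB, map_smul, blockIntertwiner_ket3, smul_smul, mul_inv_cancel₀ hd, one_smul]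

/-! ### q-factorials and a noncommutative binomial expansion. -/

theorem qPoch_succ (p : K) (n : ℕ) : qPoch p (n + 1) = qPoch p n * (1 - p ^ (n + 1)) := by
  rw [qPoch, qPoch, Finset.prod_Icc_succ_top (by omega)]

theorem qPoch_zero (p : K) : qPoch p 0 = 1 := by simp [qPoch]

theorem qPoch_ne_zero {p : K} (hp : ∀ n, 0 < n → p ^ n ≠ 1) (n : ℕ) : qPoch p n ≠ 0 := by
  rw [qPoch, Finset.prod_ne_zero_iff]
  intro j hj
  rw [Finset.mem_Icc] at hj
  exact sub_ne_zero.2 (hp j (by omega)).symm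

/-- The `p`-binomial coefficient `(p)_{l+r} / ((p)_l (p)_r)`. -/
def qBinom (p : K) (l r : ℕ) : K := qPoch p (l + r) / (qPoch p l * qPoch p r)

theorem qBinom_zero_left {p : K} (hp : ∀ n, 0 < n → p ^ n ≠ 1) (r : ℕ) : qBinom p 0 r = 1 := by
  rw [qBinom, qPoch_zero, one_mul, zero_add, div_self (qPoch_ne_zero hp r)]

theorem qBinom_zero_right {p : K} (hp : ∀ n, 0 < n → p ^ n ≠ 1) (l : ℕ) : qBinom p l 0 = 1 := by
  rw [qBinom, qPoch_zero, mul_one, add_zero, div_self (qPoch_ne_zero hp l)]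

/-- Pascal's rule comes from 1 - p^{l+r+2} = p^{r+1}(1 - p^{l+1}) + (1 - p^{r+1}). -/
theorem qBinom_succ_succ {p : K} (hp : ∀ n, 0 < n → p ^ n ≠ 1) (l r : ℕ) :
    qBinom p (l + 1) (r + 1) = p ^ (r + 1) * qBinom p l (r + 1) + qBinom p (l + 1) r := by
  have h1 : qPoch p l ≠ 0 := qPoch_ne_zero hp l
  have h2 : qPoch p r ≠ 0 := qPoch_ne_zero hp r
  have h3 : 1 - p ^ (l + 1) ≠ 0 := sub_ne_zero.2 (hp _ (by omega)).symm
  have h4 : 1 - p ^ (r + 1) ≠ 0 := sub_ne_zero.2 (hp _ (by omega)).symm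
  have e1 : l + 1 + (r + 1) = l + r + 1 + 1 := by ring
  have e2 : l + (r + 1) = l + r + 1 := by ring
  have e3 : l + 1 + r = l + r + 1 := by ring
  simp only [qBinom, e1, e2, e3, qPoch_succ]
  generalize hx : 1 - p ^ (l + 1) = x at *
  generalize hy : 1 - p ^ (r + 1) = y at *
  have hz : 1 - p ^ (l + r + 1 + 1) = p ^ (r + 1) * x + y := by
    rw [← hx, ← hy]; ring
  rw [hz]
  field_simp

/-- `∏_{t < m} (1 - p^{c-t})`. -/
def qFalling (p : K) (c m : ℕ) : K := ∏ t ∈ Finset.range m, (1 - p ^ (c - t))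

theorem qFalling_succ (p : K) (c m : ℕ) :
    qFalling p c (m + 1) = qFalling p c m * (1 - p ^ (c - m)) :=
  Finset.prod_range_succ _ _

/-- The factor t = c is 1 - p⁰ = 0. This reflects a⁻|0⟩ = 0, and it makes the truncated subtractions
in the kets below harmless. -/
theorem qFalling_eq_zero (p : K) {c m : ℕ} (h : c < m) : qFalling p c m = 0 :=
  Finset.prod_eq_zero (Finset.mem_range.2 h) (by simp)

theorem qFalling_mul_qPoch (p : K) (c m : ℕ) :
    qFalling p (c + m) m * qPoch p c = qPoch p (c + m) := by
  induction m generalizing c with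
  | zero => simp [qFalling]
  | succ m ih =>
    have h := ih (c + 1)
    rw [show c + 1 + m = c + (m + 1) by ring, qPoch_succ] at h
    rw [qFalling_succ, ← h, show c + (m + 1) - m = c + 1 by omega]
    ring

/-- Powers of an operator that acts on a family of vectors by raising one of two indices. -/
theorem pow_apply_eq_sum_antidiagonal {M : Type*} [AddCommMonoid M] [Module K M]
    (Y : Module.End K M) (e : ℕ → ℕ → M) (u w g : ℕ → ℕ → K)
    (h : ∀ l r, g l r • Y (e l r) = (g l r * u l r) • e (l + 1) r + (g l r * w l r) • e l (r + 1))
    (h0 : g 0 0 = 1) (hl : ∀ l, g (l + 1) 0 = g l 0 * u l 0) (hr : ∀ r, g 0 (r + 1) = g 0 r * w 0 r)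
    (hs : ∀ l r, g (l + 1) (r + 1) = g l (r + 1) * u l (r + 1) + g (l + 1) r * w (l + 1) r)
    (n : ℕ) : (Y ^ n) (e 0 0) = ∑ s ∈ Finset.HasAntidiagonal.antidiagonal n,
      g s.1 s.2 • e s.1 s.2 := by
  induction n with
  | zero => simp [h0]
  | succ n ih =>
    -- The two contributions arriving at (l, r), from (l-1, r) and from (l, r-1), set to zero on the
    -- boundary. Dropping one end of the antidiagonal of n+1 turns each sum into one over that of n.
    let f₁ : ℕ → ℕ → M := fun l r => Nat.casesOn l 0 fun l => (g l r * u l r) • e (l + 1) r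
    let f₂ : ℕ → ℕ → M := fun l r => Nat.casesOn r 0 fun r => (g l r * w l r) • e l (r + 1)
    have e1 : ∑ s ∈ Finset.HasAntidiagonal.antidiagonal (n + 1), g s.1 s.2 • e s.1 s.2 =
        ∑ s ∈ Finset.HasAntidiagonal.antidiagonal (n + 1), (f₁ s.1 s.2 + f₂ s.1 s.2) := by
      refine Finset.sum_congr rfl fun s hs' => ?_
      obtain ⟨l, r⟩ := s
      rw [Finset.HasAntidiagonal.mem_antidiagonal] at hs'
      rcases l with _ | l <;> rcases r with _ | r
      · simp at hs'
      · simp [f₁, f₂, hr]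
      · simp [f₁, f₂, hl]
      · simp [f₁, f₂, hs, add_smul]
    rw [e1, Finset.sum_add_distrib, Finset.Nat.sum_antidiagonal_succ,
      Finset.Nat.sum_antidiagonal_succ', pow_succ', Module.End.mul_apply, ih, map_sum]
    simp only [map_smul, h, Finset.sum_add_distrib]
    simp [f₁, f₂]

/-! ### Expansion of the monomials in the block of π₂₁₂. -/

section Monomials

variable {p : K} (c₁ c₂ : Param K)

theorem pow_tripleBlock_BA_one_two (k : ℕ) :
    (tripleBlock (blockB p c₂) (blockA p c₁) 1 2 ^ k) (ket3 K 0 0 0) =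
      (c₂.α * c₁.κ * c₂.ν) ^ k • ket3 K 0 0 k := by
  induction k with
  | zero => simp
  | succ k ih =>
    rw [pow_succ', Module.End.mul_apply, ih, map_smul, tripleBlock_BA_one_two, smul_smul, pow_succ]

/-- Here l counts the steps raising the middle factor and r those raising both outer factors. An
outer step multiplies the weight p^{a+c} of each later middle step by p², which is why the binomials
have base p². -/
theorem pow_tripleBlock_BA_two_two (hp : ∀ n, 0 < n → (p ^ 2) ^ n ≠ 1) (j k : ℕ) :
    (tripleBlock (blockB p c₂) (blockA p c₁) 2 2 ^ j) (ket3 K 0 0 k) =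
      ∑ s ∈ Finset.HasAntidiagonal.antidiagonal j,
        (qBinom (p ^ 2) s.1 s.2 * (c₂.β * c₁.ν * c₂.α) ^ s.1 *
        (c₂.ν * c₁.κ * c₂.ν) ^ s.2 * p ^ (k * s.1)) • ket3 K s.2 s.1 (k + s.2) := by
  refine pow_apply_eq_sum_antidiagonal _ (fun l r => ket3 K r l (k + r))
    (fun l r => c₂.β * c₁.ν * c₂.α * p ^ (r + (k + r))) (fun l r => c₂.ν * c₁.κ * c₂.ν)
    (fun l r => qBinom (p ^ 2) l r * (c₂.β * c₁.ν * c₂.α) ^ l *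
        (c₂.ν * c₁.κ * c₂.ν) ^ r * p ^ (k * l)) ?_ ?_ ?_ ?_ ?_ j
  · intro l r
    rw [tripleBlock_BA_two_two, smul_add, smul_smul, smul_smul, add_assoc]
  · simp [qBinom_zero_left hp]
  · intro l
    simp only [qBinom_zero_right hp]
    ring
  · intro r
    simp only [qBinom_zero_left hp]
    ring
  · intro l r
    simp only [qBinom_succ_succ hp]
    ring

/-- Here l counts the steps that lower the third factor and raise the middle one, with weight p^a(1
- p^{2c}), and r those that raise the first, with weight p^c. Exchanging two steps shifts both a and
c, so the base is again p²; the factors 1 - p^{2c} multiply to the falling product. -/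
theorem pow_tripleBlock_BA_two_one (hp : ∀ n, 0 < n → (p ^ 2) ^ n ≠ 1) (i a b c : ℕ) :
    (tripleBlock (blockB p c₂) (blockA p c₁) 2 1 ^ i) (ket3 K a b c) =
      ∑ s ∈ Finset.HasAntidiagonal.antidiagonal i,
        (qBinom (p ^ 2) s.1 s.2 * qFalling (p ^ 2) c s.1 *
        (c₂.β * c₁.ν * c₂.μ) ^ s.1 * (c₂.ν * c₁.κ * c₂.β) ^ s.2 * p ^ (a * s.1) *
        p ^ ((c - s.1) * s.2)) • ket3 K (a + s.2) (b + s.1) (c - s.1) := by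
  refine pow_apply_eq_sum_antidiagonal _ (fun l r => ket3 K (a + r) (b + l) (c - l))
    (fun l r => c₂.β * c₁.ν * c₂.μ * p ^ (a + r) * (1 - p ^ (2 * (c - l))))
    (fun l r => c₂.ν * c₁.κ * c₂.β * p ^ (c - l))
    (fun l r => qBinom (p ^ 2) l r * qFalling (p ^ 2) c l *
        (c₂.β * c₁.ν * c₂.μ) ^ l * (c₂.ν * c₁.κ * c₂.β) ^ r * p ^ (a * l) *
        p ^ ((c - l) * r)) ?_ ?_ ?_ ?_ ?_ i
  · intro l r
    rw [tripleBlock_BA_two_one, smul_add, smul_smul, smul_smul, Nat.sub_sub]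
    rfl
  · simp [qBinom_zero_left hp, qFalling]
  · intro l
    simp only [qBinom_zero_right hp, qFalling_succ]
    ring
  · intro r
    simp only [qBinom_zero_left hp]
    ring
  · intro l r
    simp only [qBinom_succ_succ hp, qFalling_succ]
    -- Once the third factor is exhausted, every term carries a vanishing factor 1 - p⁰.
    rcases lt_or_ge l c with h | h
    · obtain ⟨d, rfl⟩ : ∃ d, c = l + 1 + d := ⟨c - (l + 1), by omega⟩
      rw [show l + 1 + d - l = d + 1 by omega, show l + 1 + d - (l + 1) = d by omega]
      ring
    · rw [show c - l = 0 by omega]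
      simp

end Monomials

/-! ### The matrix elements. -/

/-- With λ = l, μ = m, j = l + r and i = m + s, the three factors are those produced by the two
power expansions. -/
theorem qBracket_eq {p : K} (hp : ∀ n, 0 < n → p ^ n ≠ 1) (l r m s c : ℕ) :
    qBracket p [((m + s : ℕ) : ℤ), ((l + r : ℕ) : ℤ), (c : ℤ) + (m : ℕ)]
      [(m : ℤ), (l : ℤ), ((m + s : ℕ) : ℤ) - m, ((l + r : ℕ) : ℤ) - l, (c : ℤ)] =
      qBinom p l r * qBinom p m s * qFalling p (c + m) m := by
  have h1 : qPoch p l ≠ 0 := qPoch_ne_zero hp l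
  have h2 : qPoch p r ≠ 0 := qPoch_ne_zero hp r
  have h3 : qPoch p m ≠ 0 := qPoch_ne_zero hp m
  have h4 : qPoch p s ≠ 0 := qPoch_ne_zero hp s
  have h5 : qPoch p c ≠ 0 := qPoch_ne_zero hp c
  have e1 : ((m + s : ℕ) : ℤ) - m = s := by push_cast; ring
  have e2 : ((l + r : ℕ) : ℤ) - l = r := by push_cast; ring
  have e3 : (c : ℤ) + (m : ℕ) = ((c + m : ℕ) : ℤ) := by push_cast; ring
  rw [e1, e2, e3, qBracket, if_pos]
  · simp only [List.map_cons, List.map_nil, List.prod_cons, List.prod_nil, Int.toNat_natCast,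
      ← qFalling_mul_qPoch, qBinom]
    field_simp
  · simp only [List.mem_cons, List.not_mem_nil, or_false, forall_eq_or_imp, forall_eq]
    exact ⟨⟨by positivity, by positivity, by positivity⟩, by positivity, by positivity,
      by positivity, by positivity, by positivity⟩

theorem qBracket_eq_zero (p : K) (num den : List ℤ) {z : ℤ} (hz : z ∈ den) (h : z < 0) :
    qBracket p num den = 0 := by
  rw [qBracket, if_neg]
  rintro ⟨-, h'⟩
  exact absurd (h' z hz) (not_le.2 h)

/-- The scalar identity behind the formula for the matrix elements. -/
theorem coefficient_identity {q : K} (hq : q ≠ 0) {c₁ c₂ : Param K} (h₁ : c₁.Admissible q)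
    (h₂ : c₂.Admissible q) (hκσ : c₁.κ = c₁.σ) (hαβ : c₁.α * c₁.β = c₂.α * c₂.β)
    {l r m s c k : ℕ} (h : k + r = c + m) (B : K) :
    ((c₁.κ * c₂.β * c₁.ν * (q ^ 2) ^ (l + r)) ^ (m + s) * (c₁.κ * c₂.ν * c₁.κ) ^ (l + r) *
        (c₁.κ * c₁.ν * c₂.α) ^ k)⁻¹ *
      ((c₂.α * c₁.κ * c₂.ν) ^ k * ((c₂.β * c₁.ν * c₂.α) ^ l * (c₂.ν * c₁.κ * c₂.ν) ^ r *
        (q ^ 2) ^ (k * l)) * ((c₂.β * c₁.ν * c₂.μ) ^ m * (c₂.ν * c₁.κ * c₂.β) ^ s *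
        (q ^ 2) ^ (r * m) * (q ^ 2) ^ (c * s)) * B) =
    (-c₁.α * c₁.β * q ^ (-2 : ℤ)) ^ (l + r) * c₁.μ ^ (((r + s : ℕ) : ℤ) - (l + r : ℕ) + k) *
      c₂.μ ^ (((l + m : ℕ) : ℤ) - (r + s : ℕ) - k) * c₁.σ ^ (l + m + (l + r)) *
      ((-1) ^ l * q ^ (2 * ((m + s : ℕ) : ℤ) * ((c : ℤ) - (l + r : ℕ)) + 2 * ((k : ℤ) + 1) * l +
        2 * (m : ℤ) * ((m : ℤ) - k)) * B) := by
  have hβ := h₂.β_ne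
  have hν := h₁.ν_ne
  have hν' := h₂.ν_ne
  have hα := h₂.α_ne
  have hκ := h₁.κ_ne
  have hg : c₁.μ * c₁.ν = c₂.μ * c₂.ν := by
    have h' := hαβ
    rw [h₁.mul_eq, h₂.mul_eq] at h'
    have hq2 : -q ^ 2 ≠ 0 := neg_ne_zero.2 (pow_ne_zero 2 hq)
    exact mul_left_cancel₀ hq2 (by linear_combination h')
  have hpre : -c₁.α * c₁.β * q ^ (-2 : ℤ) = c₂.μ * c₂.ν := by
    have : q ^ (2 : ℕ) * q ^ (-2 : ℤ) = 1 := by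
      rw [zpow_neg, zpow_ofNat, mul_inv_cancel₀ (pow_ne_zero 2 hq)]
    linear_combination (-q ^ (-2 : ℤ)) * h₁.mul_eq + c₁.μ * c₁.ν * this + hg
  rw [hpre]
  have hσ2 : ∀ n : ℕ, c₁.κ ^ (2 * n) = 1 := fun n => by
    rw [pow_mul, pow_two, hκσ, h₁.sigma_sq, one_pow]
  rw [← hκσ]
  -- This and the next two identities trade integer exponents for natural ones, so that the rest is
  -- a polynomial identity for `ring`.
  have hz : c₁.μ ^ (((r + s : ℕ) : ℤ) - (l + r : ℕ) + k) * c₁.μ ^ l = c₁.μ ^ (s + k) := by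
    rw [← zpow_natCast, ← zpow_natCast, ← zpow_add₀ h₁.μ_ne]
    congr 1
    push_cast
    ring
  have hw : c₂.μ ^ (((l + m : ℕ) : ℤ) - (r + s : ℕ) - k) * c₂.μ ^ (r + s + k) =
      c₂.μ ^ (l + m) := by
    rw [← zpow_natCast, ← zpow_natCast, ← zpow_add₀ h₂.μ_ne]
    congr 1
    push_cast
    ring
  have hv : q ^ (2 * ((m + s : ℕ) : ℤ) * ((c : ℤ) - (l + r : ℕ)) + 2 * ((k : ℤ) + 1) * l +
        2 * (m : ℤ) * ((m : ℤ) - k)) * ((q ^ 2) ^ (l + r)) ^ (m + s) =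
      (q ^ 2) ^ (k * l) * (q ^ 2) ^ (r * m) * (q ^ 2) ^ (c * s) * (q ^ 2) ^ l := by
    simp only [← pow_mul, ← pow_add]
    rw [← zpow_natCast, ← zpow_natCast, ← zpow_add₀ hq]
    congr 1
    have h' : (k : ℤ) + r = c + m := by exact_mod_cast h
    push_cast
    -- The exponents of q agree only modulo the conservation law k + r = c + m.
    linear_combination (-2 * (m : ℤ)) * h'
  generalize c₁.μ ^ (((r + s : ℕ) : ℤ) - (l + r : ℕ) + k) = z at *
  generalize c₂.μ ^ (((l + m : ℕ) : ℤ) - (r + s : ℕ) - k) = w at *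
  generalize q ^ (2 * ((m + s : ℕ) : ℤ) * ((c : ℤ) - (l + r : ℕ)) + 2 * ((k : ℤ) + 1) * l +
        2 * (m : ℤ) * ((m : ℤ) - k)) = v at *
  -- The sign (-1)^λ originates here, from αβ = -q²μν.
  have hx : (c₂.β * c₁.ν * c₂.α) ^ l = c₁.ν ^ l * ((-1) ^ l * (q ^ 2) ^ l * (c₂.μ * c₂.ν) ^ l) := by
    rw [← mul_pow, ← mul_pow, ← mul_pow]
    congr 1
    linear_combination c₁.ν * h₂.mul_eq
  have hA : c₁.μ ^ l * c₁.ν ^ l = (c₂.μ * c₂.ν) ^ l := by rw [← mul_pow, hg]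
  have hB : c₁.μ ^ (s + k) * c₁.ν ^ (s + k) = (c₂.μ * c₂.ν) ^ (s + k) := by rw [← mul_pow, hg]
  have hd : (c₁.κ * c₂.β * c₁.ν * (q ^ 2) ^ (l + r)) ^ (m + s) * (c₁.κ * c₂.ν * c₁.κ) ^ (l + r) *
        (c₁.κ * c₁.ν * c₂.α) ^ k ≠ 0 := by positivity
  rw [inv_mul_eq_iff_eq_mul₀ hd]
  have hμ : c₁.μ ^ l * c₂.μ ^ (r + s + k) ≠ 0 :=
    mul_ne_zero (pow_ne_zero _ h₁.μ_ne) (pow_ne_zero _ h₂.μ_ne)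
  refine mul_right_cancel₀ hμ ?_
  rw [hx]
  calc _ = c₂.α ^ k * c₁.κ ^ (k + r + s) * c₂.ν ^ (k + 2 * r + s) * c₁.ν ^ m * c₂.β ^ (m + s) *
        c₂.μ ^ (m + r + s + k) * B * ((-1) ^ l * (c₂.μ * c₂.ν) ^ l) * (c₁.μ ^ l * c₁.ν ^ l) *
        ((q ^ 2) ^ (k * l) * (q ^ 2) ^ (r * m) * (q ^ 2) ^ (c * s) * (q ^ 2) ^ l) := by ring
    -- An even power of κ = ±1 is inserted to match the exponents of κ on the two sides.
    _ = c₂.α ^ k * c₁.κ ^ (k + r + s) * c₁.κ ^ (2 * (m + 2 * l + r)) * c₂.ν ^ r * c₁.ν ^ m *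
        c₂.β ^ (m + s) * c₂.μ ^ m * B * (-1) ^ l * (c₂.μ * c₂.ν) ^ (l + l + r) *
        (c₁.μ ^ (s + k) * c₁.ν ^ (s + k)) *
        (v * ((q ^ 2) ^ (l + r)) ^ (m + s)) := by
      rw [hσ2, hA, hB, hv]
      ring
    _ = (c₁.κ * c₂.β * c₁.ν * (q ^ 2) ^ (l + r)) ^ (m + s) * (c₁.κ * c₂.ν * c₁.κ) ^ (l + r) *
        (c₁.κ * c₁.ν * c₂.α) ^ k * ((c₂.μ * c₂.ν) ^ (l + r) * (c₁.μ ^ (s + k)) *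
        c₂.μ ^ (l + m) * c₁.κ ^ (l + m + (l + r)) * ((-1) ^ l * v * B)) := by ring
    _ = _ := by
      rw [← hz, ← hw]
      ring

theorem matrixElement_blockIntertwiner {q : K} (hq : q ≠ 0) (hq1 : ∀ m : ℕ, 0 < m → q ^ m ≠ 1)
    {c₁ c₂ : Param K} (h₁ : c₁.Admissible q)
    (h₂ : c₂.Admissible q) (hκσ : c₁.κ = c₁.σ) (hαβ : c₁.α * c₁.β = c₂.α * c₂.β)
    (a b c i j k : ℕ) :
    matrixElement (blockIntertwiner (q ^ 2) c₁ c₂ ∘ₗ P₁₃ K) a b c i j k =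
      (-c₁.α * c₁.β * q ^ (-2 : ℤ)) ^ j * c₁.μ ^ ((a : ℤ) - j + k) *
        c₂.μ ^ ((b : ℤ) - a - k) * c₁.σ ^ (b + j) * scrS q a b c i j k := by
  have hp : ∀ n, 0 < n → ((q ^ 2) ^ 2) ^ n ≠ 1 := fun n hn => by
    rw [← pow_mul, ← pow_mul]
    exact hq1 _ (by omega)
  have hp4 : (q ^ 2) ^ 2 = q ^ 4 := by rw [← pow_mul]
  have hrepr : ∀ a' b' c' : ℕ, (basis3 K).repr (ket3 K a' b' c') ((a, b), c) =
      if a' = a ∧ b' = b ∧ c' = c then 1 else 0 := by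
    intro a' b' c'
    rw [← basis3_apply, Module.Basis.repr_self, Finsupp.single_apply]
    simp only [Prod.mk.injEq, and_assoc]
  have hP : (blockIntertwiner (q ^ 2) c₁ c₂ ∘ₗ P₁₃ K) (ket3 K i j k) =
      blockIntertwiner (q ^ 2) c₁ c₂ (ket3 K k j i) := by
    rw [LinearMap.comp_apply, ket3, P₁₃_tmul, ket3]
  rw [matrixElement, hP, blockIntertwiner_ket3, mono, pow_tripleBlock_BA_one_two]
  simp only [map_smul, pow_tripleBlock_BA_two_two c₁ c₂ hp, pow_tripleBlock_BA_two_one c₁ c₂ hp,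
    map_sum, Finset.smul_sum,
    smul_smul]
  simp only [Finsupp.coe_finsetSum, Finset.sum_apply, Finsupp.smul_apply, hrepr, smul_eq_mul,
    Finset.Nat.sum_antidiagonal_eq_sum_range_succ_mk]
  rw [← Finset.sum_product']
  -- The falling factor is needed alongside the basis condition: with truncated subtraction the
  -- third index could equal c = 0 spuriously, but then the factor vanishes.
  have hzero : ∀ x ∈ Finset.range (j + 1) ×ˢ Finset.range (i + 1),
      ¬ (i + j = a + b ∧ j + k = b + c ∧ x.1 + x.2 = b) →
      qFalling ((q ^ 2) ^ 2) (k + (j - x.1)) x.2 *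
        (if j - x.1 + (i - x.2) = a ∧ x.1 + x.2 = b ∧ k + (j - x.1) - x.2 = c then 1 else 0) =
        0 := by
    rintro ⟨x, y⟩ hxy hn
    simp only [Finset.mem_product, Finset.mem_range] at hxy hn ⊢
    rcases lt_or_ge (k + (j - x)) y with h | h
    · rw [qFalling_eq_zero _ h, zero_mul]
    · rw [if_neg, mul_zero]
      rintro ⟨e1, e2, e3⟩
      exact hn ⟨by omega, by omega, e2⟩
  by_cases hw : i + j = a + b ∧ j + k = b + c
  · rw [scrS, if_pos hw, Finset.mul_sum]
    -- The expansion only produces λ ≤ j and μ ≤ i. The remaining pairs with λ + μ = b have a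
    -- negative entry in the bracket and contribute 0.
    have hsub : (Finset.range (j + 1) ×ˢ Finset.range (i + 1)).filter (fun x => x.1 + x.2 = b) ⊆
        Finset.HasAntidiagonal.antidiagonal b := by
      intro x hx
      rw [Finset.HasAntidiagonal.mem_antidiagonal]
      exact (Finset.mem_filter.1 hx).2
    rw [← Finset.sum_subset hsub, Finset.sum_filter]
    · refine Finset.sum_congr rfl ?_
      rintro ⟨l, m⟩ hlm
      have hz := hzero (l, m) hlm
      simp only [Finset.mem_product, Finset.mem_range] at hlm hz ⊢
      by_cases hb : l + m = b
      · obtain ⟨r, rfl⟩ : ∃ r, j = l + r := ⟨j - l, by omega⟩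
        obtain ⟨s, rfl⟩ : ∃ s, i = m + s := ⟨i - m, by omega⟩
        obtain rfl : a = r + s := by omega
        subst hb
        have hc : k + r = c + m := by omega
        rw [← hp4, qBracket_eq hp, if_pos rfl, if_pos ⟨by omega, rfl, by omega⟩, mul_one,
          ← coefficient_identity hq h₁ h₂ hκσ hαβ hc]
        simp only [Nat.add_sub_cancel_left, hc, Nat.add_sub_cancel]
        ring
      · rw [if_neg hb]
        rcases mul_eq_zero.1 (hz fun h => hb h.2.2) with h | h <;> rw [h] <;> ring
    · rintro ⟨l, m⟩ hlm hn
      rw [Finset.HasAntidiagonal.mem_antidiagonal] at hlm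
      simp only [Finset.mem_filter, Finset.mem_product, Finset.mem_range, not_and] at hlm hn
      have hlt : j < l ∨ i < m := by
        by_contra h'
        rw [not_or] at h'
        exact hn ⟨by omega, by omega⟩ hlm
      have hq0 : qBracket (q ^ 4) [(i : ℤ), (j : ℤ), (c : ℤ) + m]
          [(m : ℤ), (l : ℤ), (i : ℤ) - m, (j : ℤ) - l, (c : ℤ)] = 0 := by
        rcases hlt with h | h
        · exact qBracket_eq_zero _ _ _ (z := (j : ℤ) - l) (by simp) (by omega)
        · exact qBracket_eq_zero _ _ _ (z := (i : ℤ) - m) (by simp) (by omega)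
      simp only [hq0, mul_zero]
  · rw [scrS, if_neg hw, mul_zero]
    refine Finset.sum_eq_zero fun x hx => ?_
    have hz := hzero x hx fun h => hw ⟨h.1, h.2.1⟩
    rcases mul_eq_zero.1 hz with h | h <;> rw [h] <;> ring

/-! ### Block structure of π₁₂₁ and π₂₁₂. -/

/-- The three blocks `{1, 2, 3}`, `{4}`, `{5, 6, 7}` of indices. -/
def blk : Fin 7 → ℕ := ![0, 0, 0, 1, 2, 2, 2]

/-- The indices `1, 2, 3`. -/
def upperIdx : Fin 3 → Fin 7 := ![0, 1, 2]

/-- The indices `5, 6, 7`. -/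
def lowerIdx : Fin 3 → Fin 7 := ![4, 5, 6]

theorem exists_upperIdx : ∀ i, blk i = 0 → ∃ a, i = upperIdx a := by decide

theorem exists_lowerIdx : ∀ i, blk i = 2 → ∃ a, i = lowerIdx a := by decide

theorem blk_upperIdx_ne : ∀ i, ∀ k ∉ Set.range upperIdx, blk (upperIdx i) ≠ blk k := by
  intro i k hk h
  have h0 : ∀ i, blk (upperIdx i) = 0 := by decide
  obtain ⟨a, rfl⟩ := exists_upperIdx k (by rw [← h, h0])
  exact hk ⟨a, rfl⟩

theorem blk_lowerIdx_ne : ∀ i, ∀ k ∉ Set.range lowerIdx, blk (lowerIdx i) ≠ blk k := by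
  intro i k hk h
  have h0 : ∀ i, blk (lowerIdx i) = 2 := by decide
  obtain ⟨a, rfl⟩ := exists_lowerIdx k (by rw [← h, h0])
  exact hk ⟨a, rfl⟩

/-- An intertwiner of the upper or of the lower blocks of block diagonal representations
intertwines the representations. -/
theorem intertwine_of_block {V W : Type*} [AddCommMonoid V] [Module K V] [AddCommMonoid W]
    [Module K W] {q : K} (hq : q ≠ 0) {ρ : A 3 q →ₐ[K] Module.End K V}
    {τ : A 3 q →ₐ[K] Module.End K W} {Φ : V →ₗ[K] W}
    (hρ : ∀ i j : Fin 7, blk i ≠ blk j → ρ (t 3 q i j) = 0)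
    (hτ : ∀ i j : Fin 7, blk i ≠ blk j → τ (t 3 q i j) = 0) {z : K}
    (hρz : ρ (t 3 q 3 3) = z • 1) (hτz : τ (t 3 q 3 3) = z • 1) {β : ℕ} (hβ : β = 0 ∨ β = 2)
    (h : ∀ i j : Fin 7, blk i = β → blk j = β → Φ ∘ₗ ρ (t 3 q i j) = τ (t 3 q i j) ∘ₗ Φ)
    (f : A 3 q) : Φ ∘ₗ ρ f = τ f ∘ₗ Φ := by
  refine intertwine_all (fun i j : Fin 7 => ?_) f
  by_cases hij : blk i = blk j
  · have hd := intertwine_dual (n := 3) hq (b := blk) (Φ := Φ) (by decide) hρ hτ h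
    have h3 : ∀ i : Fin 7, (blk i = 0 ∧ blk (Fin.rev i) = 2) ∨ (i = 3) ∨
        (blk i = 2 ∧ blk (Fin.rev i) = 0) := by decide
    rcases h3 i with h1 | h1 | h1
    · have h2 : blk (Fin.rev j) = 2 := by
        have : ∀ i : Fin 7, blk i = 0 → blk (Fin.rev i) = 2 := by decide
        exact this j (by rw [← hij, h1.1])
      rcases hβ with rfl | rfl
      · exact h i j h1.1 (by rw [← hij, h1.1])
      · exact hd i j h1.2 h2
    · have h2 : j = 3 := by
        have : ∀ i : Fin 7, blk i = 1 → i = 3 := by decide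
        exact this j (by rw [← hij, h1]; rfl)
      rw [h1, h2, hρz, hτz]
      ext v
      simp
    · have h2 : blk (Fin.rev j) = 0 := by
        have : ∀ i : Fin 7, blk i = 2 → blk (Fin.rev i) = 0 := by decide
        exact this j (by rw [← hij, h1.1])
      rcases hβ with rfl | rfl
      · exact hd i j h1.2 h2
      · exact h i j h1.1 (by rw [← hij, h1.1])
  · rw [hρ i j hij, hτ i j hij]
    simp

/-- The parameters of the lower blocks. -/
def Param.dual (q : K) (c : Param K) : Param K where
  α := q ^ 2 * c.β⁻¹
  β := q ^ 2 * c.α⁻¹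
  μ := c.ν⁻¹
  ν := c.μ⁻¹
  σ := c.σ
  κ := c.κ⁻¹

theorem fockRep_ap {p : K} (hp : p ≠ 0) : fockRep hp (Osc.ap p) = fockOp p OscGen.ap := by
  simp [fockRep, Osc.ap, RingQuot.liftAlgHom_mkAlgHom_apply]

theorem fockRep_am {p : K} (hp : p ≠ 0) : fockRep hp (Osc.am p) = fockOp p OscGen.am := by
  simp [fockRep, Osc.am, RingQuot.liftAlgHom_mkAlgHom_apply]

theorem fockRep_k {p : K} (hp : p ≠ 0) : fockRep hp (Osc.k p) = fockOp p OscGen.k := by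
  simp [fockRep, Osc.k, RingQuot.liftAlgHom_mkAlgHom_apply]

section Blocks

variable {q : K} (hq : q ≠ 0) {π : A 3 q →ₐ[K] Osc (q ^ 2)} {c : Param K}

theorem onFock_t (i j : Fin 7) : onFock hq π (t 3 q i j) =
    fockRep (pow_ne_zero 2 hq) (π (t 3 q i j)) := rfl

theorem onFock_pi₁_eq_zero (h : ∀ i j : Fin 7, π (t 3 q i j) = pi₁Matrix q c i j) (i j : Fin 7)
    (hij : blk i ≠ blk j) : onFock hq π (t 3 q i j) = 0 := by
  have hz : pi₁Matrix q c i j = 0 := by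
    revert hij
    fin_cases i <;> fin_cases j <;> first
      | (intro _; rfl)
      | (intro h; exact absurd rfl h)
  rw [onFock_t, h, hz, map_zero]

theorem onFock_pi₂_eq_zero (h : ∀ i j : Fin 7, π (t 3 q i j) = pi₂Matrix q c i j) (i j : Fin 7)
    (hij : blk i ≠ blk j) : onFock hq π (t 3 q i j) = 0 := by
  have hz : pi₂Matrix q c i j = 0 := by
    revert hij
    fin_cases i <;> fin_cases j <;> first
      | (intro _; rfl)
      | (intro h; exact absurd rfl h)
  rw [onFock_t, h, hz, map_zero]

theorem onFock_pi₁_upper (h : ∀ i j : Fin 7, π (t 3 q i j) = pi₁Matrix q c i j) (i j : Fin 3) :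
    onFock hq π (t 3 q (upperIdx i) (upperIdx j)) = blockA (q ^ 2) c i j := by
  rw [onFock_t, h]
  fin_cases i <;> fin_cases j <;>
    simp [upperIdx, pi₁Matrix_apply, blockA, fockRep_ap, fockRep_am, fockRep_k]

/-- Passing to the lower block exchanges the shapes diag(M, κ) and diag(κ, M); this is what makes
the inverse intertwiner accessible. -/
theorem onFock_pi₁_lower (h : ∀ i j : Fin 7, π (t 3 q i j) = pi₁Matrix q c i j) (i j : Fin 3) :
    onFock hq π (t 3 q (lowerIdx i) (lowerIdx j)) = blockB (q ^ 2) (c.dual q) i j := by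
  rw [onFock_t, h]
  fin_cases i <;> fin_cases j <;>
    simp [lowerIdx, pi₁Matrix_apply, blockB, fockRep_ap, fockRep_am, fockRep_k, Param.dual]

theorem onFock_pi₂_upper (h : ∀ i j : Fin 7, π (t 3 q i j) = pi₂Matrix q c i j) (i j : Fin 3) :
    onFock hq π (t 3 q (upperIdx i) (upperIdx j)) = blockB (q ^ 2) c i j := by
  rw [onFock_t, h]
  fin_cases i <;> fin_cases j <;>
    simp [upperIdx, pi₂Matrix_apply, blockB, fockRep_ap, fockRep_am, fockRep_k]

theorem onFock_pi₂_lower (h : ∀ i j : Fin 7, π (t 3 q i j) = pi₂Matrix q c i j) (i j : Fin 3) :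
    onFock hq π (t 3 q (lowerIdx i) (lowerIdx j)) = blockA (q ^ 2) (c.dual q) i j := by
  rw [onFock_t, h]
  fin_cases i <;> fin_cases j <;>
    simp [lowerIdx, pi₂Matrix_apply, blockA, fockRep_ap, fockRep_am, fockRep_k, Param.dual]

theorem onFock_pi₁_middle (h : ∀ i j : Fin 7, π (t 3 q i j) = pi₁Matrix q c i j) :
    onFock hq π (t 3 q (3 : Fin 7) (3 : Fin 7)) = c.σ • 1 := by
  rw [onFock_t, h]
  simp [pi₁Matrix_apply]

theorem onFock_pi₂_middle (h : ∀ i j : Fin 7, π (t 3 q i j) = pi₂Matrix q c i j) :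
    onFock hq π (t 3 q (3 : Fin 7) (3 : Fin 7)) = c.σ • 1 := by
  rw [onFock_t, h]
  simp [pi₂Matrix_apply]

variable {πa πb : A 3 q →ₐ[K] Osc (q ^ 2)}

theorem tripleRep_t_eq_zero
    (ha : ∀ i j : Fin 7, blk i ≠ blk j → onFock hq πa (t 3 q i j) = 0)
    (hb : ∀ i j : Fin 7, blk i ≠ blk j → onFock hq πb (t 3 q i j) = 0) (i j : Fin 7)
    (hij : blk i ≠ blk j) :
    tripleRep hq πa πb πa (t 3 q i j) = 0 :=
  tensorRep_t_eq_zero (n := 3) hq (b := blk) (tensorRep_t_eq_zero (n := 3) hq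
    (b := blk) ha hb) ha i j hij

theorem tripleRep_t_block
    (ha : ∀ i j : Fin 7, blk i ≠ blk j → onFock hq πa (t 3 q i j) = 0)
    (hb : ∀ i j : Fin 7, blk i ≠ blk j → onFock hq πb (t 3 q i j) = 0)
    {s : Fin 3 → Fin 7} (hs : Function.Injective s)
    (hsr : ∀ i, ∀ k ∉ Set.range s, blk (s i) ≠ blk k)
    {a b : Fin 3 → Fin 3 → Module.End K (Fock K)}
    (hsa : ∀ i j, onFock hq πa (t 3 q (s i) (s j)) = a i j)
    (hsb : ∀ i j, onFock hq πb (t 3 q (s i) (s j)) = b i j) (i j : Fin 3) :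
    tripleRep hq πa πb πa (t 3 q (s i) (s j)) = tripleBlock a b i j := by
  have h1 := tensorRep_t_block (n := 3) hq (tensorRep 3 hq (onFock hq πa) (onFock hq πb))
    (onFock hq πa) hs
    (fun i k hk => tensorRep_t_eq_zero (n := 3) hq (b := blk) ha hb (s i) k (hsr i k hk)) i (s j)
  refine h1.trans (Finset.sum_congr rfl fun l _ => ?_)
  rw [tensorRep_t_block (n := 3) hq (onFock hq πa) (onFock hq πb) hs
    (fun i k hk => ha _ _ (hsr i k hk)) i (s l), hsa]
  simp only [hsa, hsb]

theorem tripleRep_t_middle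
    (ha : ∀ i j : Fin 7, blk i ≠ blk j → onFock hq πa (t 3 q i j) = 0)
    (hb : ∀ i j : Fin 7, blk i ≠ blk j → onFock hq πb (t 3 q i j) = 0) {z : K}
    (hza : onFock hq πa (t 3 q (3 : Fin 7) (3 : Fin 7)) = z • 1)
    (hzb : onFock hq πb (t 3 q (3 : Fin 7) (3 : Fin 7)) = z • 1) :
    tripleRep hq πa πb πa (t 3 q (3 : Fin 7) (3 : Fin 7)) = (z * z * z) • 1 := by
  have hs : Function.Injective fun _ : Unit => (3 : Fin 7) := fun _ _ _ => rfl
  have hsr : ∀ k ∉ Set.range fun _ : Unit => (3 : Fin 7), blk 3 ≠ blk k := by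
    intro k hk h
    have : ∀ k, blk 3 = blk k → (3 : Fin 7) = k := by decide
    exact hk ⟨(), this k h⟩
  have h1 := tensorRep_t_block (n := 3) hq (tensorRep 3 hq (onFock hq πa) (onFock hq πb))
    (onFock hq πa) hs
    (fun i k hk => tensorRep_t_eq_zero (n := 3) hq (b := blk) ha hb 3 k (hsr k hk)) () 3
  refine h1.trans ?_
  rw [Fintype.sum_unique, tensorRep_t_block (n := 3) hq (onFock hq πa) (onFock hq πb) hs
    (fun i k hk => ha _ _ (hsr k hk)) () 3, Fintype.sum_unique, hza, hzb]
  refine TensorProduct.ext_threefold fun x y w => ?_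
  simp [TensorProduct.tmul_smul, ← TensorProduct.smul_tmul', smul_smul, mul_assoc]

end Blocks

theorem scrS_eq_scrR (q : K) (a b c i j k : ℕ) :
    scrS q a b c i j k = scrR (q ^ 2) a b c i j k := by
  rw [scrS, scrR, ← pow_mul]
  split_ifs
  · refine Finset.sum_congr rfl fun s _ => ?_
    rw [← zpow_natCast q 2, ← zpow_mul]
    congr 3
    push_cast
    ring
  · rfl

end QFunB

end

/-! ### Assembly of the theorem. -/

theorem theorem2 {K : Type*} [Field K] (q : K) (hq : q ≠ 0) (hq1 : ∀ m : ℕ, 0 < m → q ^ m ≠ 1)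
    (c₁ c₂ : QFunB.Param K) (h₁ : c₁.Admissible q) (h₂ : c₂.Admissible q)
    (hκσ : c₁.κ = c₁.σ) (hκκ : c₁.κ = c₂.κ) (hκσ' : c₂.κ = c₂.σ)
    (hαβ : c₁.α * c₁.β = c₂.α * c₂.β) :
    ∃ π₁ π₂ : QFunB.A 3 q →ₐ[K] QFunB.Osc (q ^ 2),
      (∀ i j : Fin 7, π₁ (QFunB.t 3 q i j) = QFunB.pi₁Matrix q c₁ i j) ∧
      (∀ i j : Fin 7, π₂ (QFunB.t 3 q i j) = QFunB.pi₂Matrix q c₂ i j) ∧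
      ∃ Φ : Module.End K (QFunB.Fock3 K),
        QFunB.IsNormalizedIntertwiner hq π₁ π₂ Φ ∧
        (∀ Ψ : Module.End K (QFunB.Fock3 K),
          QFunB.IsNormalizedIntertwiner hq π₁ π₂ Ψ → Ψ = Φ) ∧
        Function.Bijective Φ ∧
        ∀ a b c i j k : ℕ,
          QFunB.matrixElement (Φ ∘ₗ QFunB.P₁₃ K) a b c i j k =
              (-c₁.α * c₁.β * q ^ (-2 : ℤ)) ^ j * c₁.μ ^ ((a : ℤ) - j + k) *
                c₂.μ ^ ((b : ℤ) - a - k) * c₁.σ ^ (b + j) * QFunB.scrS q a b c i j k ∧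
          QFunB.scrS q a b c i j k = QFunB.scrR (q ^ 2) a b c i j k := by
  obtain ⟨π₁, hπ₁⟩ := QFunB.exists_pi₁ hq h₁ hκσ
  obtain ⟨π₂, hπ₂⟩ := QFunB.exists_pi₂ hq h₂ hκσ'
  have hp : q ^ 2 ≠ 0 := pow_ne_zero 2 hq
  have hσσ : c₂.σ = c₁.σ := by rw [← hκσ', ← hκκ, hκσ]
  have z₁ := QFunB.onFock_pi₁_eq_zero hq hπ₁
  have z₂ := QFunB.onFock_pi₂_eq_zero hq hπ₂
  have zρ := QFunB.tripleRep_t_eq_zero hq z₁ z₂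
  have zτ := QFunB.tripleRep_t_eq_zero hq z₂ z₁
  have mρ := QFunB.tripleRep_t_middle hq z₁ z₂ (QFunB.onFock_pi₁_middle hq hπ₁)
    (by rw [← hσσ]; exact QFunB.onFock_pi₂_middle hq hπ₂)
  have mτ := QFunB.tripleRep_t_middle hq z₂ z₁
    (by rw [← hσσ]; exact QFunB.onFock_pi₂_middle hq hπ₂) (QFunB.onFock_pi₁_middle hq hπ₁)
  have iu : StrictMono QFunB.upperIdx := by decide
  have il : StrictMono QFunB.lowerIdx := by decide
  have uρ := QFunB.tripleRep_t_block hq z₁ z₂ iu.injective QFunB.blk_upperIdx_ne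
    (QFunB.onFock_pi₁_upper hq hπ₁) (QFunB.onFock_pi₂_upper hq hπ₂)
  have uτ := QFunB.tripleRep_t_block hq z₂ z₁ iu.injective QFunB.blk_upperIdx_ne
    (QFunB.onFock_pi₂_upper hq hπ₂) (QFunB.onFock_pi₁_upper hq hπ₁)
  have lρ := QFunB.tripleRep_t_block hq z₁ z₂ il.injective QFunB.blk_lowerIdx_ne
    (QFunB.onFock_pi₁_lower hq hπ₁) (QFunB.onFock_pi₂_lower hq hπ₂)
  have lτ := QFunB.tripleRep_t_block hq z₂ z₁ il.injective QFunB.blk_lowerIdx_ne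
    (QFunB.onFock_pi₂_lower hq hπ₂) (QFunB.onFock_pi₁_lower hq hπ₁)
  have qu := QFunB.isQuantumMatrix_of_rtt (n := 3) hq (QFunB.rtt 3 q) iu (by decide)
  have ql := QFunB.isQuantumMatrix_of_rtt (n := 3) hq (QFunB.rtt 3 q) il (by decide)
  generalize hρ : QFunB.tripleRep hq π₁ π₂ π₁ = ρ at zρ mρ uρ lρ
  generalize hτ : QFunB.tripleRep hq π₂ π₁ π₂ = τ at zτ mτ uτ lτ
  -- The quantum matrix relations of the triple products are images of relations in the algebra, so
  -- no operator computation is needed.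
  have quρ : QFunB.IsQuantumMatrix (q ^ 2) (QFunB.tripleBlock (QFunB.blockA (q ^ 2) c₁)
      (QFunB.blockB (q ^ 2) c₂)) := by simpa only [uρ] using qu.map ρ
  have quτ : QFunB.IsQuantumMatrix (q ^ 2) (QFunB.tripleBlock (QFunB.blockB (q ^ 2) c₂)
      (QFunB.blockA (q ^ 2) c₁)) := by simpa only [uτ] using qu.map τ
  have qlρ : QFunB.IsQuantumMatrix (q ^ 2) (QFunB.tripleBlock
      (QFunB.blockB (q ^ 2) (c₁.dual q)) (QFunB.blockA (q ^ 2) (c₂.dual q))) := by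
    simpa only [lρ] using ql.map ρ
  have qlτ : QFunB.IsQuantumMatrix (q ^ 2) (QFunB.tripleBlock
      (QFunB.blockA (q ^ 2) (c₂.dual q)) (QFunB.blockB (q ^ 2) (c₁.dual q))) := by
    simpa only [lτ] using ql.map τ
  have sρ := QFunB.span_mono_AB hp h₁.κ_ne h₁.ν_ne h₂.α_ne h₂.β_ne h₂.ν_ne
  have dκ : (c₂.dual q).κ ≠ 0 := inv_ne_zero h₂.κ_ne
  have dν : (c₂.dual q).ν ≠ 0 := inv_ne_zero h₂.μ_ne
  have dα : (c₁.dual q).α ≠ 0 := mul_ne_zero hp (inv_ne_zero h₁.β_ne)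
  have dβ : (c₁.dual q).β ≠ 0 := mul_ne_zero hp (inv_ne_zero h₁.α_ne)
  have dν' : (c₁.dual q).ν ≠ 0 := inv_ne_zero h₁.μ_ne
  -- The vacuum is cyclic for π₁₂₁ through the upper block and for π₂₁₂ through the lower one.
  have sτ := QFunB.span_mono_AB hp dκ dν dα dβ dν'
  have bΦ := QFunB.blockIntertwiner_intertwines hp h₁.κ_ne h₁.ν_ne h₂.α_ne h₂.β_ne h₂.ν_ne hκκ hαβ
    quρ quτ
  have dαβ : (c₂.dual q).α * (c₂.dual q).β = (c₁.dual q).α * (c₁.dual q).β := by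
    simp only [QFunB.Param.dual]
    have hinv : c₂.β⁻¹ * c₂.α⁻¹ = c₁.β⁻¹ * c₁.α⁻¹ := by
      rw [← mul_inv, ← mul_inv, mul_comm c₂.β, mul_comm c₁.β, hαβ]
    linear_combination (q ^ 2 * q ^ 2) * hinv
  -- The reverse intertwiner: the same construction with the dual parameters of c₂ and c₁ in
  -- exchanged roles.
  have bΦ' := QFunB.blockIntertwiner_intertwines hp dκ dν dα dβ dν'
    (by simp only [QFunB.Param.dual, hκκ]) dαβ qlτ qlρ
  have fΦ : ∀ f, QFunB.blockIntertwiner (q ^ 2) c₁ c₂ ∘ₗ ρ f =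
      τ f ∘ₗ QFunB.blockIntertwiner (q ^ 2) c₁ c₂ := by
    refine QFunB.intertwine_of_block hq zρ zτ mρ mτ (Or.inl rfl) fun i j hi hj => ?_
    obtain ⟨a, rfl⟩ := QFunB.exists_upperIdx i hi
    obtain ⟨b, rfl⟩ := QFunB.exists_upperIdx j hj
    rw [uρ, uτ, bΦ]
  have fΦ' : ∀ f, QFunB.blockIntertwiner (q ^ 2) (c₂.dual q) (c₁.dual q) ∘ₗ τ f =
      ρ f ∘ₗ QFunB.blockIntertwiner (q ^ 2) (c₂.dual q) (c₁.dual q) := by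
    refine QFunB.intertwine_of_block hq zτ zρ mτ mρ (Or.inr rfl) fun i j hi hj => ?_
    obtain ⟨a, rfl⟩ := QFunB.exists_lowerIdx i hi
    obtain ⟨b, rfl⟩ := QFunB.exists_lowerIdx j hj
    rw [lρ, lτ, bΦ']
  have vΦ := QFunB.blockIntertwiner_vacuum (q ^ 2) c₁ c₂
  have vΦ' := QFunB.blockIntertwiner_vacuum (q ^ 2) (c₂.dual q) (c₁.dual q)
  have formula := QFunB.matrixElement_blockIntertwiner hq hq1 h₁ h₂ hκσ hαβ
  generalize QFunB.blockIntertwiner (q ^ 2) c₁ c₂ = Φ at fΦ vΦ formula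
  generalize QFunB.blockIntertwiner (q ^ 2) (c₂.dual q) (c₁.dual q) = Φ' at fΦ' vΦ'
  -- The composite commutes with π₁₂₁ and fixes its cyclic vacuum, as does the identity.
  have left_inv : Φ' ∘ₗ Φ = LinearMap.id := by
    refine QFunB.intertwiner_ext sρ (Y := QFunB.tripleBlock (QFunB.blockA (q ^ 2) c₁)
      (QFunB.blockB (q ^ 2) c₂)) (fun a b => ?_) (fun a b => rfl) ?_
    · rw [← uρ, LinearMap.comp_assoc, fΦ, ← LinearMap.comp_assoc, fΦ', LinearMap.comp_assoc]
    · rw [LinearMap.comp_apply, vΦ, vΦ', LinearMap.id_apply]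
  have right_inv : Φ ∘ₗ Φ' = LinearMap.id := by
    refine QFunB.intertwiner_ext sτ (Y := QFunB.tripleBlock
      (QFunB.blockA (q ^ 2) (c₂.dual q)) (QFunB.blockB (q ^ 2) (c₁.dual q))) (fun a b => ?_)
      (fun a b => rfl) ?_
    · rw [← lτ, LinearMap.comp_assoc, fΦ', ← LinearMap.comp_assoc, fΦ, LinearMap.comp_assoc]
    · rw [LinearMap.comp_apply, vΦ', vΦ, LinearMap.id_apply]
  refine ⟨π₁, π₂, hπ₁, hπ₂, Φ, ⟨fun f => ?_, vΦ⟩, fun Ψ hΨ => ?_, ?_, fun a b c i j k =>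
    ⟨formula a b c i j k, QFunB.scrS_eq_scrR q a b c i j k⟩⟩
  · rw [hρ, hτ]
    exact (fΦ f).symm
  · refine QFunB.intertwiner_ext sρ (fun a b => ?_) (fun a b => ?_) (hΨ.normalized.trans vΦ.symm)
      (Y := QFunB.tripleBlock (QFunB.blockB (q ^ 2) c₂) (QFunB.blockA (q ^ 2) c₁))
    · have h := hΨ.intertwines (QFunB.t 3 q (QFunB.upperIdx a) (QFunB.upperIdx b))
      rw [hρ, hτ, uρ, uτ] at h
      exact h.symm
    · rw [← uρ, ← uτ, fΦ]
  · exact Function.bijective_iff_has_inverse.2 ⟨Φ', fun v => LinearMap.congr_fun left_inv v,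
      fun v => LinearMap.congr_fun right_inv v⟩
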